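/- **Setting.** Let $A\in\mathbb R^{n\times n}$, $B\in\mathbb R^{n\times m}$, $C\in\mathbb R^{p\times n}$ with $(A,B)$ stabilizable and $(A,C)$ observable; let $Q_y=Q_y^T\ge 0$, $R=R^T>0$ with $(A,\sqrt{C^TQ_yC})$ observable. A square matrix is called Schur if all its complex eigenvalues lie strictly inside the unit circle. Let $L\in\mathbb R^{n\times p}$ be an observer gain, $A_L=A-LC$, and $\Lambda(z)=\det(zI-A_L)=z^n+\alpha_{n-1}z^{n-1}+\dots+\alpha_0$. Let $\mathcal A$ be the companion matrix with ones on the superdiagonal and last row $(-\alpha_0,\dots,-\alpha_{n-1})$, let $b=(0,\dots,0,1)^T$, and let $\mathcal A_\varepsilon\in\mathbb R^{n\times n}$ have characteristic polynomial $\Lambda$. For $F\in\mathbb R^{n\times n}$ and $v\in\mathbb R^n$ let $N(F,v)\in\mathbb R^{n\times n}$ be the matrix with $\mathrm{adj}(zI-F)v=N(F,v)\,(1,z,\dots,z^{n-1})^T$. Choose $\eta_\varepsilon(0)\in\mathbb R^n$ with $N(\mathcal A_\varepsilon,\eta_\varepsilon(0))$ nonsingular. Put $n_z=n(m+p+1)$,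 $$\mathcal G_1=\mathrm{diag}[\underbrace{\mathcal A,\dots,\mathcal A}_{m+p},\mathcal A_\varepsilon],\qquad \mathcal G_2=\mathrm{diag}[\underbrace{b,\dots,b}_{m+p},0].$$ **Data.** Let $u(k)\in\mathbb R^m$, $k\ge0$, be an arbitrary input sequence and let $x(k+1)=Ax(k)+Bu(k)$, $y(k)=Cx(k)$, $\eta(k+1)=\mathcal G_1\eta(k)+\mathcal G_2\,\mathrm{col}(u(k),y(k),0)$ with $\eta(0)=\mathrm{col}(0,\dots,0,\eta_\varepsilon(0))\in\mathbb R^{n_z}$. Denote by $B_i$, $L_j$ the columns of $B$, $L$ and set $$M=[\,N(A_L,B_1),\dots,N(A_L,B_m),\,N(A_L,L_1),\dots,N(A_L,L_p),\,N(A_L,x(0))N(\mathcal A_\varepsilon,\eta_\varepsilon(0))^{-1}\,]\in\mathbb R^{n\times n_z}.$$ For symmetric $S$ let $\mathrm{vech}(S)$ list the entries on and above the diagonal; let $\mathrm{vec}(T)$ stack the columns of $T$; let $\delta_v=\mathrm{vech}(2vv^T-\mathrm{dia}(v)^2)^T$ (so $\delta_v\mathrm{vech}(S)=v^TSv$) and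 $\delta_{v,w}=(w\otimes v)^T$ (so $\delta_{v,w}\mathrm{vec}(T)=v^TTw$). For a fixed $k_N^*\ge 0$ let $\Pi$, $\Psi$, $\mathcal L$ have the rows $[\delta_{\eta(k)},\,2\delta_{\eta(k),u(k)},\,\delta_{u(k)}]$, $\ \delta_{\eta(k+1)}$, $\ y(k)^TQ_yy(k)+u(k)^TRu(k)$, respectively, for $k=0,\dots,k_N^*$. **Algorithm 3 (model-free value iteration, without its stopping test).** Starting from $\mathcal P_0$, for $j=0,1,2,\dots$ solve $$\Pi\,\mathrm{col}\big(\mathrm{vech}\,\mathcal P^{(j)}_{\eta,\eta},\ \mathrm{vec}\,\mathcal P^{(j)}_{\eta,u},\ \mathrm{vech}\,\mathcal P^{(j)}_{u,u}\big)=\Psi\,\mathrm{vech}(\mathcal P_j)+\mathcal L$$ for symmetric $\mathcal P^{(j)}_{\eta,\eta}$, symmetric $\mathcal P^{(j)}_{u,u}$ and arbitrary $\mathcal P^{(j)}_{\eta,u}\in\mathbb R^{n_z\times m}$, and set $$\mathcal P_{j+1}=\mathcal P^{(j)}_{\eta,\eta}-\mathcal P^{(j)}_{\eta,u}(\mathcal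 P^{(j)}_{u,u})^{-1}(\mathcal P^{(j)}_{\eta,u})^T,\qquad \mathcal K_j=(\mathcal P^{(j)}_{u,u})^{-1}(\mathcal P^{(j)}_{\eta,u})^T.$$ **Theorem.** Assume the data rank condition $\operatorname{rank}\Pi=\frac{(n_z+m)(n_z+m+1)}2$ and $\operatorname{rank}M=n$. Let $\mathcal P_0=\mathcal P_0^T\ge0$ in $\mathbb R^{n_z\times n_z}$; $\mathcal P_0$ is arbitrary if the observer matrix $A_L$ is Schur, and if $A_L$ is not Schur, $\mathcal P_0$ is assumed to be of the form $M^TP_0M$ with $P_0=P_0^T\ge0$ in $\mathbb R^{n\times n}$. Then the Riccati equation $A^TPA-P+C^TQ_yC-A^TPB(R+B^TPB)^{-1}B^TPA=0$ has exactly one positive semidefinite solution $P^*$; Algorithm 3 is well defined from $\mathcal P_0$ (at every iteration the linear equation has exactly one solution, and $\mathcal P^{(j)}_{u,u}$ is invertible); and $$\lim_{j\to\infty}\mathcal K_j=\mathcal K^*:=K^*M,\qquad K^*=(R+B^TP^*B)^{-1}B^TP^*A.$$ -/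

import Mathlib

open Matrix Filter Topology
open scoped Kronecker

noncomputable section

/-! ## Linear systems -/

/-- A real square matrix is Schur if its complex spectrum lies strictly inside the unit circle. -/
def IsSchur {ι : Type*} [Fintype ι] [DecidableEq ι] (F : Matrix ι ι ℝ) : Prop :=
  ∀ μ ∈ spectrum ℂ (F.map Complex.ofReal), ‖μ‖ < 1

/-- `(A, B)` is stabilizable: some static state feedback `u = -K x` makes `A - B K` Schur. -/
def Stabilizable {n m : ℕ} (A : Matrix (Fin n) (Fin n) ℝ) (B : Matrix (Fin n) (Fin m) ℝ) : Prop :=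
  ∃ K : Matrix (Fin m) (Fin n) ℝ, IsSchur (A - B * K)

/-- `(A, C)` is observable: only the zero initial state of `x(k+1) = A x(k)` yields the output
`C x(k) = 0` for all `k`. -/
def Observable {n p : ℕ} (A : Matrix (Fin n) (Fin n) ℝ) (C : Matrix (Fin p) (Fin n) ℝ) : Prop :=
  ∀ v : Fin n → ℝ, (∀ k : ℕ, (C * A ^ k) *ᵥ v = 0) → v = 0

/-- `S` is the positive semidefinite square root of `T`. -/
def IsPSDSqrt {n : ℕ} (S T : Matrix (Fin n) (Fin n) ℝ) : Prop :=
  S.PosSemidef ∧ S * S = T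

/-- The discrete algebraic Riccati equation with state weight `Q` and input weight `R`. -/
def IsRiccatiSolution {n m : ℕ} (A : Matrix (Fin n) (Fin n) ℝ) (B : Matrix (Fin n) (Fin m) ℝ)
    (Q : Matrix (Fin n) (Fin n) ℝ) (R : Matrix (Fin m) (Fin m) ℝ)
    (P : Matrix (Fin n) (Fin n) ℝ) : Prop :=
  Aᵀ * P * A - P + Q - Aᵀ * P * B * (R + Bᵀ * P * B)⁻¹ * Bᵀ * P * A = 0

/-- The state feedback gain `(R + Bᵀ P B)⁻¹ Bᵀ P A` associated with `P`. -/
def stateGain {n m : ℕ} (A : Matrix (Fin n) (Fin n) ℝ) (B : Matrix (Fin n) (Fin m) ℝ)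
    (R : Matrix (Fin m) (Fin m) ℝ) (P : Matrix (Fin n) (Fin n) ℝ) : Matrix (Fin m) (Fin n) ℝ :=
  (R + Bᵀ * P * B)⁻¹ * Bᵀ * P * A

/-! ## The internal model and the parameterization matrix -/

/-- Dimension of the internal state. -/
abbrev dimEta (n m p : ℕ) : ℕ := n * (m + p + 1)

/-- Block coordinates of the internal state `col(η_u¹, …, η_uᵐ, η_y¹, …, η_yᵖ, η_ε)`:
`m` blocks for the inputs, `p` blocks for the outputs and one block for the observer error, each
of size `n`. -/
abbrev EtaBlock (n m p : ℕ) : Type := (Fin m × Fin n) ⊕ ((Fin p × Fin n) ⊕ Fin n)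

/-- The enumeration of the block coordinates in the order of the stacked vector. -/
def etaEquiv (n m p : ℕ) : EtaBlock n m p ≃ Fin (dimEta n m p) :=
  ((Equiv.sumCongr finProdFinEquiv
      ((Equiv.sumCongr finProdFinEquiv (Equiv.refl (Fin n))).trans finSumFinEquiv)).trans
    finSumFinEquiv).trans
    (finCongr (show m * n + (p * n + n) = n * (m + p + 1) by ring))

/-- The companion matrix in controllable canonical form: ones on the superdiagonal, last row
`-α₀, …, -α_{n-1}`, for `Λ(z) = zⁿ + α_{n-1} z^{n-1} + ⋯ + α₀`. -/
def companionMat (n : ℕ) (Λ : Polynomial ℝ) : Matrix (Fin n) (Fin n) ℝ :=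
  Matrix.of fun i j =>
    if (i : ℕ) + 1 = n then -Λ.coeff j else if (j : ℕ) = (i : ℕ) + 1 then 1 else 0

/-- The input vector `b = col(0, …, 0, 1)`, as a one-column matrix. -/
def lastCol (n : ℕ) : Matrix (Fin n) (Fin 1) ℝ :=
  Matrix.of fun i _ => if (i : ℕ) + 1 = n then 1 else 0

/-- The numerator coefficients of `(z I - F)⁻¹ v = adj(z I - F) v / det(z I - F)`: the column with
index `l` is the coefficient of `zˡ` in the polynomial vector `adj(z I - F) v`. -/
def numeratorMat {n : ℕ} (F : Matrix (Fin n) (Fin n) ℝ) (v : Fin n → ℝ) :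
    Matrix (Fin n) (Fin n) ℝ :=
  Matrix.of fun i l => ((F.charmatrix.adjugate *ᵥ fun a => Polynomial.C (v a)) i).coeff (l : ℕ)

/-- The matrix `M = [M_u¹, …, M_uᵐ, M_y¹, …, M_yᵖ, M_{ε_x ← η_ε}]` for the observer
`x̂(k+1) = (A - L C) x̂(k) + B u(k) + L y(k)`, `x̂(0) = 0`, with initial observer error
`ε_x(0) = x₀ - x̂(0) = x₀`. The last block is `M_{ε_x} M_{η_ε}⁻¹`. -/
def paramMat {n m p : ℕ} (A : Matrix (Fin n) (Fin n) ℝ) (B : Matrix (Fin n) (Fin m) ℝ)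
    (C : Matrix (Fin p) (Fin n) ℝ) (L : Matrix (Fin n) (Fin p) ℝ) (x₀ : Fin n → ℝ)
    (Aε : Matrix (Fin n) (Fin n) ℝ) (ηε₀ : Fin n → ℝ) :
    Matrix (Fin n) (Fin (dimEta n m p)) ℝ :=
  (Matrix.fromCols (Matrix.of fun r (c : Fin m × Fin n) =>
      numeratorMat (A - L * C) (fun a => B a c.1) r c.2)
    (Matrix.fromCols (Matrix.of fun r (c : Fin p × Fin n) =>
        numeratorMat (A - L * C) (fun a => L a c.1) r c.2)
      (numeratorMat (A - L * C) x₀ * (numeratorMat Aε ηε₀)⁻¹))).submatrix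
    id (etaEquiv n m p).symm

/-- `𝒢₁ = block diag[𝒜, …, 𝒜, 𝒜_ε]` with `m + p` copies of the companion matrix of `Λ`. -/
def internalG1 (n m p : ℕ) (Λ : Polynomial ℝ) (Aε : Matrix (Fin n) (Fin n) ℝ) :
    Matrix (Fin (dimEta n m p)) (Fin (dimEta n m p)) ℝ :=
  (Matrix.fromBlocks ((1 : Matrix (Fin m) (Fin m) ℝ) ⊗ₖ companionMat n Λ) 0 0
    (Matrix.fromBlocks ((1 : Matrix (Fin p) (Fin p) ℝ) ⊗ₖ companionMat n Λ) 0 0 Aε)).submatrix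
    (etaEquiv n m p).symm (etaEquiv n m p).symm

/-- `𝒢₂ = block diag[b, …, b, 0]` with `m + p` copies of `b`; it acts on `ζ = col(u, y, 0)`. -/
def internalG2 (n m p : ℕ) :
    Matrix (Fin (dimEta n m p)) ((Fin m × Fin 1) ⊕ ((Fin p × Fin 1) ⊕ Fin 1)) ℝ :=
  (Matrix.fromBlocks ((1 : Matrix (Fin m) (Fin m) ℝ) ⊗ₖ lastCol n) 0 0
    (Matrix.fromBlocks ((1 : Matrix (Fin p) (Fin p) ℝ) ⊗ₖ lastCol n) 0 0 0)).submatrix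
    (etaEquiv n m p).symm id

/-- `ζ = col(u, y, 0)`. -/
def zetaVec {m p : ℕ} (u : Fin m → ℝ) (y : Fin p → ℝ) :
    (Fin m × Fin 1) ⊕ ((Fin p × Fin 1) ⊕ Fin 1) → ℝ :=
  Sum.elim (fun c => u c.1) (Sum.elim (fun c => y c.1) 0)

/-- The initial internal state `η(0) = col(0, …, 0, η_ε(0))`. -/
def etaInit (n m p : ℕ) (ηε₀ : Fin n → ℝ) : Fin (dimEta n m p) → ℝ :=
  (Sum.elim 0 (Sum.elim 0 ηε₀) : EtaBlock n m p → ℝ) ∘ (etaEquiv n m p).symm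

/-! ## Data regressors -/

/-- Positions of the upper triangle of an `N × N` matrix. -/
abbrev UpperIdx (N : ℕ) : Type := {q : Fin N × Fin N // q.1 ≤ q.2}

/-- The half-vectorization of a symmetric matrix: its entries on and above the diagonal. -/
def vech {N : ℕ} (S : Matrix (Fin N) (Fin N) ℝ) : UpperIdx N → ℝ :=
  fun q => S q.1.1 q.1.2

/-- `δ_v = vech(2 v vᵀ - dia(v)²)`, so that `δ_v · vech S = vᵀ S v` for symmetric `S`. -/
def deltaQuad {N : ℕ} (v : Fin N → ℝ) : UpperIdx N → ℝ :=
  vech ((2 : ℝ) • Matrix.vecMulVec v v - Matrix.diagonal v ^ 2)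

/-- `δ_{v,w} = (w ⊗ v)ᵀ`, so that `δ_{v,w} · vec T = vᵀ T w`. -/
def deltaBilin {N m : ℕ} (v : Fin N → ℝ) (w : Fin m → ℝ) : Fin m × Fin N → ℝ :=
  fun q => w q.1 * v q.2

/-- Index set of the unknowns `col(vech 𝒫_{ηη}, vec 𝒫_{ηu}, vech 𝒫_{uu})`. -/
abbrev UnknownIdx (N m : ℕ) : Type := UpperIdx N ⊕ ((Fin m × Fin N) ⊕ UpperIdx m)

/-- `Π(k_N)`, whose rows are `φ(k) = [δ_η(k), 2 δ_{η,u}(k), δ_u(k)]` for `k = 0, …, k_N`. -/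
def dataPi {N m : ℕ} (η : ℕ → Fin N → ℝ) (u : ℕ → Fin m → ℝ) (kN : ℕ) :
    Matrix (Fin (kN + 1)) (UnknownIdx N m) ℝ :=
  Matrix.of fun k => Sum.elim (deltaQuad (η k))
    (Sum.elim ((2 : ℝ) • deltaBilin (η k) (u k)) (deltaQuad (u k)))

/-- `Ψ(k_N)`, whose rows are `ψ(k) = δ_η(k+1)` for `k = 0, …, k_N`. -/
def dataPsi {N : ℕ} (η : ℕ → Fin N → ℝ) (kN : ℕ) : Matrix (Fin (kN + 1)) (UpperIdx N) ℝ :=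
  Matrix.of fun k => deltaQuad (η (k + 1))

/-- `ℒ(k_N)`, whose entries are the measured utilities `yᵀ(k) Q_y y(k) + uᵀ(k) R u(k)`. -/
def dataCost {m p : ℕ} (y : ℕ → Fin p → ℝ) (u : ℕ → Fin m → ℝ) (Qy : Matrix (Fin p) (Fin p) ℝ)
    (R : Matrix (Fin m) (Fin m) ℝ) (kN : ℕ) : Fin (kN + 1) → ℝ :=
  fun k => y k ⬝ᵥ Qy *ᵥ y k + u k ⬝ᵥ R *ᵥ u k

/-! ## The model-free value iteration -/

/-- The quantities of one iteration: `𝒫_j`, `𝒫_{ηη}^{(j)}`, `𝒫_{ηu}^{(j)}`, `𝒫_{uu}^{(j)}`. -/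
structure VIIterate (N m : ℕ) where
  P : Matrix (Fin N) (Fin N) ℝ
  Pηη : Matrix (Fin N) (Fin N) ℝ
  Pηu : Matrix (Fin N) (Fin m) ℝ
  Puu : Matrix (Fin m) (Fin m) ℝ

/-- The estimated gain `𝒦_j = (𝒫_{uu}^{(j)})⁻¹ (𝒫_{ηu}^{(j)})ᵀ`. -/
def VIIterate.gain {N m : ℕ} (s : VIIterate N m) : Matrix (Fin m) (Fin N) ℝ :=
  s.Puu⁻¹ * s.Pηuᵀ

/-- The learning equation of one iteration: `𝒫_{ηη}` and `𝒫_{uu}` are symmetric and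
`Φ col(vech 𝒫_{ηη}, vec 𝒫_{ηu}, vech 𝒫_{uu}) = Ψ vech 𝒫 + ℒ`. -/
def VIIterate.Learned {N m kN : ℕ} (Φ : Matrix (Fin (kN + 1)) (UnknownIdx N m) ℝ)
    (Ψ : Matrix (Fin (kN + 1)) (UpperIdx N) ℝ) (ℒ : Fin (kN + 1) → ℝ)
    (s : VIIterate N m) : Prop :=
  s.Pηη.IsSymm ∧ s.Puu.IsSymm ∧
    Φ *ᵥ Sum.elim (vech s.Pηη) (Sum.elim s.Pηu.vec (vech s.Puu)) = Ψ *ᵥ vech s.P + ℒ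

/-- A run of the model-free value iteration from `P₀` on the data `Φ, Ψ, ℒ`, continued without
stopping. -/
def IsVIRun {N m kN : ℕ} (Φ : Matrix (Fin (kN + 1)) (UnknownIdx N m) ℝ)
    (Ψ : Matrix (Fin (kN + 1)) (UpperIdx N) ℝ) (ℒ : Fin (kN + 1) → ℝ)
    (P₀ : Matrix (Fin N) (Fin N) ℝ) (s : ℕ → VIIterate N m) : Prop :=
  (s 0).P = P₀ ∧
    ∀ j, (s j).Learned Φ Ψ ℒ ∧
      (s (j + 1)).P = (s j).Pηη - (s j).Pηu * (s j).Puu⁻¹ * (s j).Pηuᵀ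

end

noncomputable section

/-! ## Schur matrices -/

/-! Write `Q = CᵀQ_yC`. The internal model carries an exact copy of the plant: `M` intertwines the
companion blocks with `A - LC`, sends the input columns to `B` and `L`, and maps `η(0)` to `x(0)`;
hence `x(k) = M η(k)` for all `k`. Substituting `y = C M η` gives a lifted linear system `η⁺ = 𝒜η +
𝓑u` with `M𝒜 = AM`, `M𝓑 = B` and stage cost `ηᵀ(MᵀQM)η + uᵀRu`. The data rank condition is full
column rank, so the learning equation has a single solution, the model-based one, and the algorithm
is exactly Riccati iteration for the lifted system (`isVIRun_iff`).

For the plant, iteration from zero increases and is bounded by the cost of a stabilizing feedback,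
so it converges to a fixed point `P`. Observability makes every positive semidefinite fixed point
stabilizing (`isSchur_closedLoop`), whence uniqueness and, by a sandwich, convergence from any `X ≥
0` (`tendsto_riccatiMap_iterate`).

The lifted weight vanishes on `ker M`, so observability is not available upstairs. Instead `X ↦
MᵀXM` conjugates the two Riccati maps (`riccatiMap_pullback`). This settles initial values of
pullback form. For arbitrary ones the sandwich needs a Schur lifted closed loop: its eigenvalues
come from `A - BK*` or, on `ker M`, from `𝒢₁`, which is Schur when `A - LC` is
(`isSchur_of_intertwining`). Continuity of the gain finishes the proof. -/

theorem mem_spectrum_iff_exists_eigenvector {ι : Type*} [Fintype ι] [DecidableEq ι]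
    (F : Matrix ι ι ℂ) (μ : ℂ) :
    μ ∈ spectrum ℂ F ↔ ∃ w : ι → ℂ, w ≠ 0 ∧ F *ᵥ w = μ • w := by
  rw [spectrum.mem_iff, Matrix.isUnit_iff_isUnit_det, isUnit_iff_ne_zero, not_not,
    ← Matrix.exists_mulVec_eq_zero_iff]
  refine exists_congr fun w => and_congr_right fun _ => ?_
  rw [Matrix.sub_mulVec, sub_eq_zero, Algebra.algebraMap_eq_smul_one, Matrix.smul_mulVec,
    Matrix.one_mulVec, eq_comm]

theorem isSchur_iff_eigenvector {ι : Type*} [Fintype ι] [DecidableEq ι] (F : Matrix ι ι ℝ) :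
    IsSchur F ↔ ∀ (μ : ℂ) (w : ι → ℂ), w ≠ 0 → F.map Complex.ofReal *ᵥ w = μ • w → ‖μ‖ < 1 := by
  constructor
  · exact fun h μ w hw hF => h μ ((mem_spectrum_iff_exists_eigenvector _ _).2 ⟨w, hw, hF⟩)
  · intro h μ hμ
    obtain ⟨w, hw, hF⟩ := (mem_spectrum_iff_exists_eigenvector _ _).1 hμ
    exact h μ w hw hF

/-- By Gelfand's formula, `‖a ^ k‖ ≤ r ^ k` eventually, for any `r` strictly between the spectral
radius and 1. -/
theorem summable_norm_pow_of_spectralRadius_lt_one {A : Type*} [NormedRing A] [NormedAlgebra ℂ A]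
    [CompleteSpace A] (a : A) (h : spectralRadius ℂ a < 1) : Summable fun k : ℕ => ‖a ^ k‖ := by
  obtain ⟨r, hr, hr1⟩ := ENNReal.lt_iff_exists_nnreal_btwn.1 h
  have hr1' : r < 1 := by exact_mod_cast hr1
  have ht := spectrum.pow_nnnorm_pow_one_div_tendsto_nhds_spectralRadius a
  have hev := (ht.eventually_lt_const hr).and (eventually_gt_atTop 0)
  refine Summable.of_norm_bounded_eventually_nat (g := fun k => (r : ℝ) ^ k)
    (summable_geometric_of_lt_one r.2 (by exact_mod_cast hr1')) ?_
  filter_upwards [hev] with k hk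
  have hk0 : (0 : ℝ) < k := by exact_mod_cast hk.2
  have h1 := ENNReal.rpow_lt_rpow hk.1 hk0
  rw [← ENNReal.rpow_mul, one_div_mul_cancel hk0.ne', ENNReal.rpow_one, ENNReal.rpow_natCast] at h1
  rw [norm_norm, ← coe_nnnorm]
  exact_mod_cast h1.le

section Frobenius

attribute [local instance] Matrix.frobeniusNormedRing Matrix.frobeniusNormedAlgebra
  Matrix.frobeniusNormedAddCommGroup Matrix.frobeniusNormedSpace

theorem IsSchur.summable_frobenius_norm_pow {N : ℕ} {F : Matrix (Fin N) (Fin N) ℝ}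
    (hF : IsSchur F) : Summable fun k : ℕ => ‖F ^ k‖ := by
  rcases Nat.eq_zero_or_pos N with rfl | hN
  · have : ∀ k : ℕ, ‖F ^ k‖ = 0 := fun k => by rw [Subsingleton.elim (F ^ k) 0, norm_zero]
    simp [this, summable_zero]
  have : Nonempty (Fin N) := ⟨⟨0, hN⟩⟩
  have : CompleteSpace (Matrix (Fin N) (Fin N) ℂ) := FiniteDimensional.complete ℂ _
  have hs : spectralRadius ℂ (F.map Complex.ofReal) < 1 := by
    have := spectrum.spectralRadius_lt_of_forall_lt (F.map Complex.ofReal) (r := 1)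
      (fun k hk => by exact_mod_cast hF k hk)
    simpa using this
  have := summable_norm_pow_of_spectralRadius_lt_one _ hs
  refine this.congr fun k => ?_
  have hk : F.map Complex.ofReal ^ k = (F ^ k).map Complex.ofReal :=
    (map_pow (Complex.ofRealHom.mapMatrix (m := Fin N)) F k).symm
  rw [hk]
  exact Matrix.frobenius_norm_map_eq _ _ fun a => Complex.norm_real a

theorem IsSchur.tendsto_pow {N : ℕ} {F : Matrix (Fin N) (Fin N) ℝ} (hF : IsSchur F) :
    Tendsto (fun k : ℕ => F ^ k) atTop (𝓝 0) :=
  squeeze_zero_norm (fun _ => le_rfl) hF.summable_frobenius_norm_pow.tendsto_atTop_zero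

theorem IsSchur.summable_conj {N : ℕ} {F : Matrix (Fin N) (Fin N) ℝ} (hF : IsSchur F)
    (W : Matrix (Fin N) (Fin N) ℝ) : Summable fun k : ℕ => (F ^ k)ᵀ * W * F ^ k := by
  have : CompleteSpace (Matrix (Fin N) (Fin N) ℝ) := FiniteDimensional.complete ℝ _
  have hs := hF.summable_frobenius_norm_pow
  -- One of the two powers is absorbed into a uniform bound; the other supplies summability.
  obtain ⟨c, hc⟩ := hs.tendsto_atTop_zero.bddAbove_range
  refine Summable.of_norm_bounded (g := fun k => c * ‖W‖ * ‖F ^ k‖) (hs.mul_left _) fun k => ?_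
  refine (norm_mul_le _ _).trans (mul_le_mul_of_nonneg_right ?_ (norm_nonneg _))
  refine (norm_mul_le _ _).trans (mul_le_mul_of_nonneg_right ?_ (norm_nonneg _))
  rw [Matrix.frobenius_norm_transpose]
  exact hc ⟨k, rfl⟩

end Frobenius

/-! ## Quadratic forms of real matrices -/

/-- The quadratic form `vᵀ X v`. -/
def quad {N : ℕ} (X : Matrix (Fin N) (Fin N) ℝ) (v : Fin N → ℝ) : ℝ := v ⬝ᵥ X *ᵥ v

theorem quad_add {N : ℕ} (X Y : Matrix (Fin N) (Fin N) ℝ) (v : Fin N → ℝ) :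
    quad (X + Y) v = quad X v + quad Y v := by
  simp [quad, Matrix.add_mulVec]

theorem quad_sub {N : ℕ} (X Y : Matrix (Fin N) (Fin N) ℝ) (v : Fin N → ℝ) :
    quad (X - Y) v = quad X v - quad Y v := by
  simp [quad, Matrix.sub_mulVec]

theorem quad_zero_left {N : ℕ} (v : Fin N → ℝ) : quad 0 v = 0 := by simp [quad]

theorem quad_zero_right {N : ℕ} (X : Matrix (Fin N) (Fin N) ℝ) : quad X 0 = 0 := by simp [quad]

theorem quad_sum {N : ℕ} {ι : Type*} (s : Finset ι) (X : ι → Matrix (Fin N) (Fin N) ℝ)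
    (v : Fin N → ℝ) : quad (∑ i ∈ s, X i) v = ∑ i ∈ s, quad (X i) v := by
  simp only [quad, Matrix.sum_mulVec, dotProduct_sum]

theorem quad_conj {N N' : ℕ} (X : Matrix (Fin N) (Fin N) ℝ) (T : Matrix (Fin N) (Fin N') ℝ)
    (v : Fin N' → ℝ) : quad (Tᵀ * X * T) v = quad X (T *ᵥ v) := by
  simp only [quad, ← Matrix.mulVec_mulVec]
  rw [Matrix.dotProduct_mulVec, Matrix.vecMul_transpose]

theorem quad_continuous {N : ℕ} : Continuous fun z : Matrix (Fin N) (Fin N) ℝ × (Fin N → ℝ) =>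
    quad z.1 z.2 := by
  unfold quad
  fun_prop

theorem posSemidef_iff_quad {N : ℕ} {X : Matrix (Fin N) (Fin N) ℝ} :
    X.PosSemidef ↔ X.IsSymm ∧ ∀ v, 0 ≤ quad X v := by
  rw [Matrix.posSemidef_iff_dotProduct_mulVec]
  simp [quad, Matrix.IsHermitian, Matrix.IsSymm, Matrix.conjTranspose_eq_transpose_of_trivial]

theorem Matrix.PosSemidef.transpose_eq {N : ℕ} {X : Matrix (Fin N) (Fin N) ℝ}
    (hX : X.PosSemidef) : Xᵀ = X := (posSemidef_iff_quad.1 hX).1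

theorem Matrix.PosSemidef.quad_nonneg {N : ℕ} {X : Matrix (Fin N) (Fin N) ℝ}
    (hX : X.PosSemidef) (v : Fin N → ℝ) : 0 ≤ quad X v := (posSemidef_iff_quad.1 hX).2 v

theorem Matrix.PosSemidef.transpose_mul_mul_same {N N' : ℕ} {X : Matrix (Fin N) (Fin N) ℝ}
    (hX : X.PosSemidef) (T : Matrix (Fin N) (Fin N') ℝ) : (Tᵀ * X * T).PosSemidef := by
  simpa [Matrix.conjTranspose_eq_transpose_of_trivial] using hX.conjTranspose_mul_mul_same T

/-- Polarization: equality and convergence of symmetric matrices reduce to scalar statements about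
their quadratic forms. -/
theorem entry_eq_quad {N : ℕ} {X : Matrix (Fin N) (Fin N) ℝ} (hX : Xᵀ = X) (i j : Fin N) :
    X i j = (quad X (Pi.single i 1 + Pi.single j 1) - quad X (Pi.single i 1)
      - quad X (Pi.single j 1)) / 2 := by
  have h : X j i = X i j := congrFun (congrFun hX i) j
  simp only [quad, Matrix.mulVec_add, dotProduct_add, add_dotProduct, Matrix.mulVec_single_one,
    single_one_dotProduct, Matrix.col_apply]
  rw [h]
  ring

theorem eq_of_quad_eq {N : ℕ} {X Y : Matrix (Fin N) (Fin N) ℝ} (hX : Xᵀ = X) (hY : Yᵀ = Y)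
    (h : ∀ v, quad X v = quad Y v) : X = Y := by
  ext i j
  rw [entry_eq_quad hX, entry_eq_quad hY, h, h, h]

theorem tendsto_of_tendsto_quad {N : ℕ} {X : ℕ → Matrix (Fin N) (Fin N) ℝ}
    {Y : Matrix (Fin N) (Fin N) ℝ} (hX : ∀ j, (X j)ᵀ = X j) (hY : Yᵀ = Y)
    (h : ∀ v, Tendsto (fun j => quad (X j) v) atTop (𝓝 (quad Y v))) :
    Tendsto X atTop (𝓝 Y) := by
  refine tendsto_pi_nhds.2 fun i => tendsto_pi_nhds.2 fun k => ?_
  rw [entry_eq_quad hY]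
  simp only [fun j => entry_eq_quad (hX j) i k]
  exact (((h _).sub (h _)).sub (h _)).div_const 2

theorem exists_tendsto_of_monotone_quad {N : ℕ} {X : ℕ → Matrix (Fin N) (Fin N) ℝ}
    (hX : ∀ j, (X j)ᵀ = X j) (hmono : ∀ v, Monotone fun j => quad (X j) v)
    (hbdd : ∀ v, BddAbove (Set.range fun j => quad (X j) v)) : ∃ Y, Tendsto X atTop (𝓝 Y) := by
  have hq : ∀ v, ∃ c, Tendsto (fun j => quad (X j) v) atTop (𝓝 c) := fun v =>
    ⟨_, tendsto_atTop_ciSup (hmono v) (hbdd v)⟩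
  choose c hc using hq
  refine ⟨Matrix.of fun i k => (c (Pi.single i 1 + Pi.single k 1) - c (Pi.single i 1)
      - c (Pi.single k 1)) / 2, tendsto_pi_nhds.2 fun i => tendsto_pi_nhds.2 fun k => ?_⟩
  simp only [fun j => entry_eq_quad (hX j) i k]
  exact (((hc _).sub (hc _)).sub (hc _)).div_const 2

theorem posSemidef_of_tendsto {N : ℕ} {X : ℕ → Matrix (Fin N) (Fin N) ℝ}
    {Y : Matrix (Fin N) (Fin N) ℝ} (hX : ∀ j, (X j).PosSemidef) (h : Tendsto X atTop (𝓝 Y)) :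
    Y.PosSemidef := by
  refine posSemidef_iff_quad.2 ⟨?_, fun v => ?_⟩
  · have h1 : Tendsto (fun j => (X j)ᵀ) atTop (𝓝 Yᵀ) :=
      (continuous_id.matrix_transpose.tendsto Y).comp h
    simp only [fun j => (hX j).transpose_eq] at h1
    exact tendsto_nhds_unique h1 h
  · have h1 : Tendsto (fun j => quad (X j) v) atTop (𝓝 (quad Y v)) :=
      (quad_continuous.tendsto (Y, v)).comp (h.prodMk_nhds tendsto_const_nhds)
    exact ge_of_tendsto' h1 fun j => (hX j).quad_nonneg v

/-! ## The Riccati operator -/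

/-- The Riccati operator, i.e. one step of value iteration. -/
def riccatiMap {n m : ℕ} (A : Matrix (Fin n) (Fin n) ℝ) (B : Matrix (Fin n) (Fin m) ℝ)
    (Q : Matrix (Fin n) (Fin n) ℝ) (R : Matrix (Fin m) (Fin m) ℝ)
    (X : Matrix (Fin n) (Fin n) ℝ) : Matrix (Fin n) (Fin n) ℝ :=
  Aᵀ * X * A + Q - Aᵀ * X * B * (R + Bᵀ * X * B)⁻¹ * Bᵀ * X * A

theorem isRiccatiSolution_iff {n m : ℕ} {A : Matrix (Fin n) (Fin n) ℝ}
    {B : Matrix (Fin n) (Fin m) ℝ} {Q : Matrix (Fin n) (Fin n) ℝ} {R : Matrix (Fin m) (Fin m) ℝ}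
    {P : Matrix (Fin n) (Fin n) ℝ} :
    IsRiccatiSolution A B Q R P ↔ riccatiMap A B Q R P = P := by
  rw [IsRiccatiSolution, riccatiMap, ← sub_eq_zero (b := P)]
  refine Eq.congr ?_ rfl
  abel

section

variable {n m : ℕ} {A : Matrix (Fin n) (Fin n) ℝ} {B : Matrix (Fin n) (Fin m) ℝ}
  {Q : Matrix (Fin n) (Fin n) ℝ} {R : Matrix (Fin m) (Fin m) ℝ} {X Y P : Matrix (Fin n) (Fin n) ℝ}

theorem posDef_inputWeight (hR : R.PosDef) (hX : X.PosSemidef) : (R + Bᵀ * X * B).PosDef :=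
  hR.add_posSemidef (hX.transpose_mul_mul_same B)

theorem isUnit_det_inputWeight (hR : R.PosDef) (hX : X.PosSemidef) :
    IsUnit (R + Bᵀ * X * B).det :=
  (Matrix.isUnit_iff_isUnit_det _).1 (posDef_inputWeight hR hX).isUnit

/-- One step with any gain `K` costs the Riccati value plus a square with positive definite weight,
so `stateGain` is the minimizer. Both the upper bound for arbitrary gains and the closed-loop
formula follow from this identity. -/
theorem completion_of_squares (A : Matrix (Fin n) (Fin n) ℝ) (Q : Matrix (Fin n) (Fin n) ℝ)
    (hR : R.PosDef) (hX : X.PosSemidef)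
    (K : Matrix (Fin m) (Fin n) ℝ) :
    (A - B * K)ᵀ * X * (A - B * K) + Q + Kᵀ * R * K = riccatiMap A B Q R X
      + (K - stateGain A B R X)ᵀ * (R + Bᵀ * X * B) * (K - stateGain A B R X) := by
  have hu := isUnit_det_inputWeight (B := B) hR hX
  have hGt : (R + Bᵀ * X * B)ᵀ = R + Bᵀ * X * B :=
    (posDef_inputWeight hR hX).posSemidef.transpose_eq
  have hXt := hX.transpose_eq
  have hGG : ∀ Z : Matrix (Fin m) (Fin n) ℝ,
      (R + Bᵀ * X * B) * ((R + Bᵀ * X * B)⁻¹ * Z) = Z := fun Z => by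
    rw [← Matrix.mul_assoc, Matrix.mul_nonsing_inv _ hu, Matrix.one_mul]
  have hKG : (stateGain A B R X)ᵀ * (R + Bᵀ * X * B) = Aᵀ * X * B := by
    simp only [stateGain, Matrix.transpose_mul, Matrix.transpose_nonsing_inv, hGt, hXt,
      Matrix.transpose_transpose]
    rw [← Matrix.mul_assoc Aᵀ, ← Matrix.mul_assoc (Aᵀ * X), Matrix.mul_assoc (Aᵀ * X * B),
      Matrix.nonsing_inv_mul _ hu, Matrix.mul_one]
  have hGK : (R + Bᵀ * X * B) * stateGain A B R X = Bᵀ * X * A := by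
    simp only [stateGain, Matrix.mul_assoc]
    rw [← Matrix.mul_assoc Bᵀ X B, hGG]
  have hK : Aᵀ * X * B * (R + Bᵀ * X * B)⁻¹ * Bᵀ * X * A = Aᵀ * X * B * stateGain A B R X := by
    simp only [stateGain, Matrix.mul_assoc]
  rw [riccatiMap, hK, Matrix.transpose_sub K, Matrix.sub_mul _ _ (R + Bᵀ * X * B), hKG,
    Matrix.sub_mul (Kᵀ * (R + Bᵀ * X * B)), Matrix.mul_sub (Kᵀ * (R + Bᵀ * X * B)),
    Matrix.mul_assoc Kᵀ (R + Bᵀ * X * B) (stateGain A B R X), hGK]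
  simp only [Matrix.transpose_sub, Matrix.transpose_mul, Matrix.sub_mul, Matrix.mul_sub,
    Matrix.add_mul, Matrix.mul_add, Matrix.mul_assoc]
  abel

theorem riccatiMap_eq_closedLoop (A : Matrix (Fin n) (Fin n) ℝ) (Q : Matrix (Fin n) (Fin n) ℝ)
    (hR : R.PosDef) (hX : X.PosSemidef) :
    riccatiMap A B Q R X = (A - B * stateGain A B R X)ᵀ * X * (A - B * stateGain A B R X) + Q
      + (stateGain A B R X)ᵀ * R * stateGain A B R X := by
  rw [completion_of_squares A Q hR hX, sub_self, Matrix.mul_zero, add_zero]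

theorem quad_riccatiMap_le (A : Matrix (Fin n) (Fin n) ℝ) (Q : Matrix (Fin n) (Fin n) ℝ)
    (hR : R.PosDef) (hX : X.PosSemidef) (K : Matrix (Fin m) (Fin n) ℝ)
    (v : Fin n → ℝ) : quad (riccatiMap A B Q R X) v
      ≤ quad X ((A - B * K) *ᵥ v) + quad (Q + Kᵀ * R * K) v := by
  have h := congrArg (quad · v) (completion_of_squares (B := B) A Q hR hX K)
  simp only [quad_add, quad_conj (R + Bᵀ * X * B), quad_conj X (A - B * K)] at h
  have := (posDef_inputWeight (B := B) hR hX).posSemidef.quad_nonneg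
    ((K - stateGain A B R X) *ᵥ v)
  rw [quad_add] at this
  rw [quad_add]
  linarith [quad_conj X B ((K - stateGain A B R X) *ᵥ v)]

theorem quad_riccatiMap_eq (A : Matrix (Fin n) (Fin n) ℝ) (Q : Matrix (Fin n) (Fin n) ℝ)
    (hR : R.PosDef) (hX : X.PosSemidef) (v : Fin n → ℝ) :
    quad (riccatiMap A B Q R X) v = quad X ((A - B * stateGain A B R X) *ᵥ v)
      + quad (Q + (stateGain A B R X)ᵀ * R * stateGain A B R X) v := by
  rw [riccatiMap_eq_closedLoop A Q hR hX, quad_add, quad_add, quad_conj X, quad_add, add_assoc]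

theorem riccatiMap_posSemidef (hQ : Q.PosSemidef) (hR : R.PosDef) (hX : X.PosSemidef) :
    (riccatiMap A B Q R X).PosSemidef := by
  rw [riccatiMap_eq_closedLoop A Q hR hX]
  exact ((hX.transpose_mul_mul_same _).add hQ).add (hR.posSemidef.transpose_mul_mul_same _)

/-- The optimal gain for `Y` is admissible, though suboptimal, for `X`. -/
theorem quad_riccatiMap_mono (hR : R.PosDef) (hX : X.PosSemidef) (hY : Y.PosSemidef)
    (h : ∀ v, quad X v ≤ quad Y v) (v : Fin n → ℝ) :
    quad (riccatiMap A B Q R X) v ≤ quad (riccatiMap A B Q R Y) v := by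
  rw [quad_riccatiMap_eq A Q hR hY]
  exact (quad_riccatiMap_le A Q hR hX _ v).trans (by gcongr; exact h _)

theorem riccatiMap_iterate_posSemidef (hQ : Q.PosSemidef) (hR : R.PosDef) (hX : X.PosSemidef)
    (j : ℕ) : ((riccatiMap A B Q R)^[j] X).PosSemidef := by
  induction j with
  | zero => exact hX
  | succ j ih =>
    rw [Function.iterate_succ_apply']
    exact riccatiMap_posSemidef hQ hR ih

theorem quad_riccatiMap_iterate_mono (hQ : Q.PosSemidef) (hR : R.PosDef) (hX : X.PosSemidef)
    (hY : Y.PosSemidef) (h : ∀ v, quad X v ≤ quad Y v) (j : ℕ) (v : Fin n → ℝ) :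
    quad ((riccatiMap A B Q R)^[j] X) v ≤ quad ((riccatiMap A B Q R)^[j] Y) v := by
  induction j generalizing v with
  | zero => exact h v
  | succ j ih =>
    rw [Function.iterate_succ_apply', Function.iterate_succ_apply']
    exact quad_riccatiMap_mono hR (riccatiMap_iterate_posSemidef hQ hR hX j)
      (riccatiMap_iterate_posSemidef hQ hR hY j) ih v

/-! ### Continuity and convergence of value iteration -/

theorem continuousAt_inv_inputWeight (hR : R.PosDef) (hX : X.PosSemidef) :
    ContinuousAt (fun Z : Matrix (Fin n) (Fin n) ℝ => (R + Bᵀ * Z * B)⁻¹) X := by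
  have hc : Continuous fun Z : Matrix (Fin n) (Fin n) ℝ => R + Bᵀ * Z * B := by fun_prop
  have hdet : (R + Bᵀ * X * B).det ≠ 0 := (isUnit_det_inputWeight hR hX).ne_zero
  simp only [Matrix.inv_def, Ring.inverse_eq_inv']
  exact (hc.matrix_det.continuousAt.inv₀ hdet).smul hc.matrix_adjugate.continuousAt

theorem continuousAt_stateGain (hR : R.PosDef) (hX : X.PosSemidef) :
    ContinuousAt (stateGain A B R) X := by
  have hc : Continuous fun z : Matrix (Fin m) (Fin m) ℝ × Matrix (Fin n) (Fin n) ℝ =>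
      z.1 * Bᵀ * z.2 * A := by fun_prop
  exact ContinuousAt.comp (f := fun Z : Matrix (Fin n) (Fin n) ℝ => ((R + Bᵀ * Z * B)⁻¹, Z))
    (g := fun z : Matrix (Fin m) (Fin m) ℝ × Matrix (Fin n) (Fin n) ℝ =>
      z.1 * Bᵀ * z.2 * A) hc.continuousAt
    ((continuousAt_inv_inputWeight hR hX).prodMk continuousAt_id)

theorem continuousAt_riccatiMap (hR : R.PosDef) (hX : X.PosSemidef) :
    ContinuousAt (riccatiMap A B Q R) X := by
  have hc : Continuous fun z : Matrix (Fin m) (Fin m) ℝ × Matrix (Fin n) (Fin n) ℝ =>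
      Aᵀ * z.2 * A + Q - Aᵀ * z.2 * B * z.1 * Bᵀ * z.2 * A := by fun_prop
  exact ContinuousAt.comp (f := fun Z : Matrix (Fin n) (Fin n) ℝ => ((R + Bᵀ * Z * B)⁻¹, Z))
    (g := fun z : Matrix (Fin m) (Fin m) ℝ × Matrix (Fin n) (Fin n) ℝ =>
      Aᵀ * z.2 * A + Q - Aᵀ * z.2 * B * z.1 * Bᵀ * z.2 * A) hc.continuousAt
    ((continuousAt_inv_inputWeight hR hX).prodMk continuousAt_id)

theorem riccatiMap_eq_of_tendsto (hQ : Q.PosSemidef) (hR : R.PosDef) (hX : X.PosSemidef)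
    (h : Tendsto (fun j => (riccatiMap A B Q R)^[j] X) atTop (𝓝 P)) :
    P.PosSemidef ∧ riccatiMap A B Q R P = P := by
  have hP := posSemidef_of_tendsto (riccatiMap_iterate_posSemidef hQ hR hX) h
  refine ⟨hP, tendsto_nhds_unique ?_ (h.comp (tendsto_add_atTop_nat 1))⟩
  simp only [Function.comp_def, Function.iterate_succ_apply']
  exact (continuousAt_riccatiMap hR hP).tendsto.comp h

/-- Value iteration from zero converges for a stabilizable system. -/
theorem exists_tendsto_riccatiMap_iterate_zero (hAB : Stabilizable A B) (hQ : Q.PosSemidef)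
    (hR : R.PosDef) : ∃ P, Tendsto (fun j => (riccatiMap A B Q R)^[j] 0) atTop (𝓝 P) := by
  obtain ⟨K, hK⟩ := hAB
  have h0 : (0 : Matrix (Fin n) (Fin n) ℝ).PosSemidef := .zero
  have hpsd := riccatiMap_iterate_posSemidef (A := A) (B := B) hQ hR h0
  refine exists_tendsto_of_monotone_quad (fun j => (hpsd j).transpose_eq) (fun v => ?_)
    fun v => ?_
  · refine monotone_nat_of_le_succ fun j => ?_
    -- Peel the innermost application: step `j + 1` is the `j`-th iterate started at the image of
    -- zero, which dominates zero.
    rw [Function.iterate_succ_apply]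
    refine quad_riccatiMap_iterate_mono hQ hR h0 (riccatiMap_posSemidef hQ hR h0) (fun w => ?_) j v
    rw [quad_zero_left]
    exact (riccatiMap_posSemidef hQ hR h0).quad_nonneg w
  -- The fixed stabilizing gain `K` bounds the iterates by partial sums of its own cost, a
  -- convergent series.
  · have hle : ∀ j v, quad ((riccatiMap A B Q R)^[j] 0) v
        ≤ ∑ i ∈ Finset.range j, quad (Q + Kᵀ * R * K) ((A - B * K) ^ i *ᵥ v) := by
      intro j
      induction j with
      | zero => simp [quad_zero_left]
      | succ j ih =>
        intro v
        rw [Function.iterate_succ_apply', Finset.sum_range_succ']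
        refine (quad_riccatiMap_le A Q hR (hpsd j) K v).trans ?_
        rw [pow_zero, Matrix.one_mulVec]
        gcongr
        refine (ih _).trans_eq (Finset.sum_congr rfl fun i _ => ?_)
        rw [Matrix.mulVec_mulVec, ← pow_succ]
    have hs := (hK.summable_conj (Q + Kᵀ * R * K)).hasSum.tendsto_sum_nat
    have hq := ((quad_continuous.tendsto (_, v)).comp (hs.prodMk_nhds tendsto_const_nhds))
    obtain ⟨c, hc⟩ := hq.bddAbove_range
    refine ⟨c, ?_⟩
    rintro _ ⟨j, rfl⟩
    refine (hle j v).trans (le_trans (le_of_eq ?_) (hc ⟨j, rfl⟩))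
    simp only [Function.comp_def, quad_sum, quad_conj]

/-- Any value iteration is bounded above through the closed loop of a fixed point. -/
theorem quad_riccatiMap_iterate_le (hQ : Q.PosSemidef) (hR : R.PosDef) (hX : X.PosSemidef)
    (hP : P.PosSemidef) (hfix : riccatiMap A B Q R P = P) (j : ℕ) (v : Fin n → ℝ) :
    quad ((riccatiMap A B Q R)^[j] X) v
      ≤ quad P v + quad (X - P) ((A - B * stateGain A B R P) ^ j *ᵥ v) := by
  induction j generalizing v with
  | zero => simp [quad_sub]
  | succ j ih =>
    rw [Function.iterate_succ_apply']
    have h1 := quad_riccatiMap_le (B := B) A Q hR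
      (riccatiMap_iterate_posSemidef (A := A) (B := B) hQ hR hX j)
      (stateGain A B R P) v
    have h2 := quad_riccatiMap_eq (B := B) A Q hR hP v
    have h3 := ih ((A - B * stateGain A B R P) *ᵥ v)
    rw [hfix] at h2
    rw [Matrix.mulVec_mulVec, ← pow_succ] at h3
    linarith

theorem tendsto_quad_pow {T : Matrix (Fin n) (Fin n) ℝ} (hT : IsSchur T)
    (W : Matrix (Fin n) (Fin n) ℝ) (v : Fin n → ℝ) :
    Tendsto (fun j : ℕ => quad W (T ^ j *ᵥ v)) atTop (𝓝 0) := by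
  have h1 : Tendsto (fun j : ℕ => T ^ j *ᵥ v) atTop (𝓝 ((0 : Matrix (Fin n) (Fin n) ℝ) *ᵥ v)) :=
    ((continuous_id.matrix_mulVec continuous_const).tendsto _).comp hT.tendsto_pow
  have h2 := (quad_continuous.tendsto (W, _)).comp
    ((tendsto_const_nhds (x := W) (f := atTop)).prodMk_nhds h1)
  simpa [quad_zero_right, Function.comp_def] using h2

/-- Iteration from `Y` stays at `Y`, while its upper bound through the closed loop of `P` decays to
`P`. Only `P` has to be stabilizing, so two stabilizing fixed points dominate each other. -/
theorem quad_le_of_fixedPoint (hQ : Q.PosSemidef) (hR : R.PosDef) (hY : Y.PosSemidef)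
    (hYfix : riccatiMap A B Q R Y = Y) (hP : P.PosSemidef) (hfix : riccatiMap A B Q R P = P)
    (hT : IsSchur (A - B * stateGain A B R P)) (v : Fin n → ℝ) : quad Y v ≤ quad P v := by
  have h := (tendsto_quad_pow hT (Y - P) v).const_add (quad P v)
  rw [add_zero] at h
  refine ge_of_tendsto' h fun j => ?_
  have := quad_riccatiMap_iterate_le hQ hR hY hP hfix j v
  rwa [Function.iterate_fixed hYfix] at this

/-- If value iteration from zero converges to a stabilizing fixed point, then so does value
iteration from every positive semidefinite initial value. -/
theorem tendsto_riccatiMap_iterate (hQ : Q.PosSemidef) (hR : R.PosDef) (hX : X.PosSemidef)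
    (hP : P.PosSemidef) (hfix : riccatiMap A B Q R P = P)
    (hT : IsSchur (A - B * stateGain A B R P))
    (h0 : Tendsto (fun j => (riccatiMap A B Q R)^[j] 0) atTop (𝓝 P)) :
    Tendsto (fun j => (riccatiMap A B Q R)^[j] X) atTop (𝓝 P) := by
  refine tendsto_of_tendsto_quad
    (fun j => (riccatiMap_iterate_posSemidef hQ hR hX j).transpose_eq) hP.transpose_eq fun v => ?_
  have hup := (tendsto_quad_pow hT (X - P) v).const_add (quad P v)
  rw [add_zero] at hup
  have hlow : Tendsto (fun j => quad ((riccatiMap A B Q R)^[j] 0) v) atTop (𝓝 (quad P v)) :=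
    (quad_continuous.tendsto (P, v)).comp (h0.prodMk_nhds tendsto_const_nhds)
  refine tendsto_of_tendsto_of_tendsto_of_le_of_le hlow hup (fun j => ?_)
    (fun j => quad_riccatiMap_iterate_le hQ hR hX hP hfix j v)
  refine quad_riccatiMap_iterate_mono hQ hR .zero hX (fun w => ?_) j v
  rw [quad_zero_left]
  exact hX.quad_nonneg w

end

/-! ## Schur closed loops -/

theorem map_ofReal_mul_mulVec {α β γ : Type*} [Fintype β] [Fintype γ] (M : Matrix α β ℝ)
    (F : Matrix β γ ℝ) (w : γ → ℂ) :
    (M * F).map Complex.ofReal *ᵥ w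
      = M.map Complex.ofReal *ᵥ (F.map Complex.ofReal *ᵥ w) := by
  rw [Matrix.mulVec_mulVec]
  congr 1
  exact Matrix.map_mul (f := Complex.ofRealHom)

theorem map_ofReal_mulVec_re {α β : Type*} [Fintype β] (F : Matrix α β ℝ) (w : β → ℂ) :
    F *ᵥ (fun i => (w i).re) = fun i => ((F.map Complex.ofReal *ᵥ w) i).re := by
  ext i
  simp [Matrix.mulVec, dotProduct]

theorem map_ofReal_mulVec_im {α β : Type*} [Fintype β] (F : Matrix α β ℝ) (w : β → ℂ) :
    F *ᵥ (fun i => (w i).im) = fun i => ((F.map Complex.ofReal *ᵥ w) i).im := by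
  ext i
  simp [Matrix.mulVec, dotProduct]

theorem eq_zero_of_quad_eq_zero {N : ℕ} {R : Matrix (Fin N) (Fin N) ℝ} (hR : R.PosDef)
    {v : Fin N → ℝ} (h : quad R v = 0) : v = 0 := by
  by_contra hv
  have := hR.dotProduct_mulVec_pos hv
  rw [star_trivial] at this
  exact this.ne' h

/-- A real matrix acts on the real and imaginary parts of an eigenvector for `r + s i` by this
scaled rotation; the cross terms cancel, so complex eigenvectors can be treated with real quadratic
forms. -/
theorem quad_rotation {N : ℕ} (P : Matrix (Fin N) (Fin N) ℝ) (a b : Fin N → ℝ) (r s : ℝ) :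
    quad P (r • a - s • b) + quad P (s • a + r • b)
      = (r ^ 2 + s ^ 2) * (quad P a + quad P b) := by
  simp only [quad, Matrix.mulVec_add, Matrix.mulVec_sub, Matrix.mulVec_smul, dotProduct_add,
    dotProduct_sub, add_dotProduct, sub_dotProduct, smul_dotProduct, dotProduct_smul, smul_eq_mul]
  ring

/-- Under observability of the state weight, every positive semidefinite fixed point of the
Riccati operator is stabilizing. -/
theorem isSchur_closedLoop {n m : ℕ} {A : Matrix (Fin n) (Fin n) ℝ} {B : Matrix (Fin n) (Fin m) ℝ}
    {Q S P : Matrix (Fin n) (Fin n) ℝ} {R : Matrix (Fin m) (Fin m) ℝ} (hR : R.PosDef)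
    (hS : IsPSDSqrt S Q) (hAS : Observable A S) (hP : P.PosSemidef)
    (hfix : riccatiMap A B Q R P = P) : IsSchur (A - B * stateGain A B R P) := by
  rw [isSchur_iff_eigenvector]
  intro μ w hw hF
  set K := stateGain A B R P with hK
  by_contra hμ
  set a : Fin n → ℝ := fun i => (w i).re with ha
  set b : Fin n → ℝ := fun i => (w i).im with hb
  have hTa : (A - B * K) *ᵥ a = μ.re • a - μ.im • b := by
    rw [ha, map_ofReal_mulVec_re, hF]
    ext i
    simp [hb]
  have hTb : (A - B * K) *ᵥ b = μ.im • a + μ.re • b := by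
    rw [hb, map_ofReal_mulVec_im, hF]
    ext i
    simp [ha, add_comm]
  have hμ2 : 1 ≤ μ.re ^ 2 + μ.im ^ 2 := by
    have h1 : (1 : ℝ) ≤ ‖μ‖ ^ 2 := one_le_pow₀ (not_lt.1 hμ)
    rwa [Complex.sq_norm, Complex.normSq_apply, ← sq, ← sq] at h1
  have hQ : ∀ v, quad Q v = (S *ᵥ v) ⬝ᵥ (S *ᵥ v) := fun v => by
    have : Q = Sᵀ * 1 * S := by rw [hS.1.transpose_eq, Matrix.mul_one, hS.2]
    rw [this, quad_conj, quad, Matrix.one_mulVec]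
  have hQ0 : ∀ v, 0 ≤ quad Q v := fun v => by
    rw [hQ]
    exact Finset.sum_nonneg fun i _ => mul_self_nonneg _
  have hR0 := fun v => hR.posSemidef.quad_nonneg (K *ᵥ v)
  have hstep : ∀ v, quad P v = quad P ((A - B * K) *ᵥ v) + (quad Q v + quad R (K *ᵥ v)) := by
    intro v
    have := quad_riccatiMap_eq (B := B) A Q hR hP v
    rwa [hfix, ← hK, quad_add, quad_conj R] at this
  -- If `|μ| ≥ 1`, the total `P`-value of `a` and `b` cannot decrease along the closed loop, yet it
  -- drops by the stage cost. Hence the stage cost vanishes.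
  have hsum : quad Q a + quad R (K *ᵥ a) + (quad Q b + quad R (K *ᵥ b)) ≤ 0 := by
    have h1 := quad_rotation P a b μ.re μ.im
    rw [← hTa, ← hTb] at h1
    nlinarith [hstep a, hstep b, hP.quad_nonneg a, hP.quad_nonneg b]
  have hkill : ∀ v, quad Q v ≤ 0 → quad R (K *ᵥ v) ≤ 0 →
      S *ᵥ v = 0 ∧ A *ᵥ v = (A - B * K) *ᵥ v := by
    intro v h1 h2
    constructor
    · exact dotProduct_self_eq_zero.1 ((hQ v).symm.trans (le_antisymm h1 (hQ0 v)))
    · rw [Matrix.sub_mulVec, ← Matrix.mulVec_mulVec,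
        eq_zero_of_quad_eq_zero hR (le_antisymm h2 (hR0 v)), Matrix.mulVec_zero, sub_zero]
  obtain ⟨hSa, hAa⟩ := hkill a (by linarith [hQ0 b, hR0 a, hR0 b])
    (by linarith [hQ0 a, hQ0 b, hR0 b])
  obtain ⟨hSb, hAb⟩ := hkill b (by linarith [hQ0 a, hR0 a, hR0 b])
    (by linarith [hQ0 a, hQ0 b, hR0 a])
  -- With zero feedback on `a` and `b`, their span is invariant under `A` and lies in the kernel of
  -- `S`, contradicting observability.
  have hall : ∀ k : ℕ, (S * A ^ k) *ᵥ a = 0 ∧ (S * A ^ k) *ᵥ b = 0 := by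
    intro k
    induction k with
    | zero => simp [hSa, hSb]
    | succ k ih =>
      rw [pow_succ, ← Matrix.mul_assoc, ← Matrix.mulVec_mulVec a, ← Matrix.mulVec_mulVec b, hAa,
        hAb, hTa, hTb, Matrix.mulVec_sub, Matrix.mulVec_add]
      simp [Matrix.mulVec_smul, ih.1, ih.2]
  have ha0 := hAS a fun k => (hall k).1
  have hb0 := hAS b fun k => (hall k).2
  exact hw (funext fun i => Complex.ext (congrFun ha0 i) (congrFun hb0 i))

/-- An eigenvector `w` of `F` either has `Mw ≠ 0`, and then `Mw` is an eigenvector of `T`, or has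
`Mw = 0`, and then `Fw = Gw`. -/
theorem isSchur_of_intertwining {n N : ℕ} {F G : Matrix (Fin N) (Fin N) ℝ}
    {M : Matrix (Fin n) (Fin N) ℝ} {E : Matrix (Fin N) (Fin n) ℝ} {T : Matrix (Fin n) (Fin n) ℝ}
    (hMF : M * F = T * M) (hF : F = G + E * M) (hT : IsSchur T) (hG : IsSchur G) : IsSchur F := by
  rw [isSchur_iff_eigenvector] at hT hG ⊢
  intro μ w hw hw'
  by_cases hz : M.map Complex.ofReal *ᵥ w = 0
  · refine hG μ w hw ?_
    have hFm : F.map Complex.ofReal = G.map Complex.ofReal + (E * M).map Complex.ofReal := by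
      rw [hF]
      exact Matrix.map_add Complex.ofReal Complex.ofReal_add G (E * M)
    rw [hFm, Matrix.add_mulVec, map_ofReal_mul_mulVec, hz, Matrix.mulVec_zero, add_zero] at hw'
    exact hw'
  · refine hT μ _ hz ?_
    rw [← map_ofReal_mul_mulVec, ← hMF, map_ofReal_mul_mulVec, hw', Matrix.mulVec_smul]

/-! ## Schur block matrices -/

theorem IsSchur.submatrix_equiv {ι κ : Type*} [Fintype ι] [DecidableEq ι] [Fintype κ]
    [DecidableEq κ] {F : Matrix ι ι ℝ} (hF : IsSchur F) (e : κ ≃ ι) :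
    IsSchur (F.submatrix e e) := by
  rw [isSchur_iff_eigenvector] at hF ⊢
  intro μ w hw hw'
  refine hF μ (w ∘ e.symm) (fun h => hw ?_) ?_
  · ext i
    simpa using congrFun h (e i)
  · rw [← Matrix.submatrix_map, Matrix.submatrix_mulVec_equiv] at hw'
    ext i
    simpa using congrFun hw' (e.symm i)

theorem IsSchur.fromBlocks {ι κ : Type*} [Fintype ι] [DecidableEq ι] [Fintype κ]
    [DecidableEq κ] {F : Matrix ι ι ℝ} {G : Matrix κ κ ℝ} (hF : IsSchur F) (hG : IsSchur G) :
    IsSchur (Matrix.fromBlocks F 0 0 G) := by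
  rw [isSchur_iff_eigenvector] at hF hG ⊢
  intro μ w hw hw'
  rw [Matrix.fromBlocks_map, Matrix.fromBlocks_mulVec] at hw'
  by_cases h : w ∘ Sum.inl = 0
  · refine hG μ (w ∘ Sum.inr) (fun h' => hw ?_) ?_
    · ext (i | i)
      · exact congrFun h i
      · exact congrFun h' i
    · ext i
      simpa [h] using congrFun hw' (Sum.inr i)
  · refine hF μ (w ∘ Sum.inl) h ?_
    ext i
    have h0 : (0 : Matrix ι κ ℝ).map Complex.ofReal = 0 := Matrix.map_zero _ Complex.ofReal_zero
    simpa [h0] using congrFun hw' (Sum.inl i)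

theorem IsSchur.one_kronecker {ι κ : Type*} [Fintype ι] [DecidableEq ι] [Fintype κ]
    [DecidableEq κ] {F : Matrix ι ι ℝ} (hF : IsSchur F) :
    IsSchur ((1 : Matrix κ κ ℝ) ⊗ₖ F) := by
  rw [isSchur_iff_eigenvector] at hF ⊢
  intro μ w hw hw'
  obtain ⟨⟨c, i⟩, hci⟩ := Function.ne_iff.1 hw
  refine hF μ (fun l => w (c, l)) (fun h => hci (congrFun h i)) ?_
  ext l
  have := congrFun hw' (c, l)
  simpa [Matrix.mulVec, dotProduct, Fintype.sum_prod_type, Matrix.one_apply, apply_ite, ite_mul]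
    using this

theorem isSchur_of_roots {n : ℕ} {F : Matrix (Fin n) (Fin n) ℝ} :
    IsSchur F ↔ ∀ μ : ℂ, (F.charpoly.map Complex.ofRealHom).IsRoot μ → ‖μ‖ < 1 := by
  refine forall_congr' fun μ => ?_
  rw [← Matrix.charpoly_map, Matrix.mem_spectrum_iff_isRoot_charpoly]
  rfl

/-- The superdiagonal rows force an eigenvector to be `w 0 • (1, μ, …, μⁿ⁻¹)`; the last row then
says `Λ(μ) w 0 = 0`. -/
theorem isSchur_companionMat {n : ℕ} {Λ : Polynomial ℝ} (hΛ : Λ.Monic) (hn : Λ.natDegree = n)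
    (hroots : ∀ μ : ℂ, (Λ.map Complex.ofRealHom).IsRoot μ → ‖μ‖ < 1) :
    IsSchur (companionMat n Λ) := by
  rw [isSchur_iff_eigenvector]
  intro μ w hw hw'
  obtain _ | n := n
  · exact absurd (Subsingleton.elim w 0) hw
  have hrow : ∀ k (hk : k < n + 1), w ⟨k, hk⟩ = μ ^ k * w 0 := by
    intro k
    induction k with
    | zero => simp
    | succ k ih =>
      intro hk
      have h := congrFun hw' ⟨k, by omega⟩
      have hne : k ≠ n := by omega
      have : (∑ j : Fin (n + 1), ((companionMat (n + 1) Λ ⟨k, by omega⟩ j : ℝ) : ℂ) * w j)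
          = w ⟨k + 1, hk⟩ := by
        rw [Finset.sum_eq_single ⟨k + 1, hk⟩]
        · simp [companionMat, hne]
        · intro j _ hj
          have : (j : ℕ) ≠ k + 1 := fun h => hj (Fin.ext h)
          simp [companionMat, hne, this]
        · simp
      simp only [Matrix.mulVec, dotProduct, Matrix.map_apply, Pi.smul_apply, smul_eq_mul] at h
      rw [this, ih (by omega)] at h
      rw [h, pow_succ']
      ring
  have hw0 : w 0 ≠ 0 := by
    intro h0
    refine hw (funext fun i => ?_)
    have := hrow i i.2
    simpa [h0] using this
  refine hroots μ ?_
  have h := congrFun hw' (Fin.last n)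
  simp only [Matrix.mulVec, dotProduct, Matrix.map_apply, Pi.smul_apply, smul_eq_mul,
    companionMat, Matrix.of_apply, Fin.val_last, if_true] at h
  have hev : (Λ.map Complex.ofRealHom).eval μ
      = μ ^ (n + 1) + ∑ j : Fin (n + 1), (Λ.coeff j : ℂ) * μ ^ (j : ℕ) := by
    conv_lhs => rw [hΛ.as_sum, hn]
    simp [Finset.sum_range, Polynomial.map_sum, Polynomial.eval_finsetSum]
  rw [Polynomial.IsRoot, hev]
  refine (mul_eq_zero.1 (?_ : _ * w 0 = 0)).resolve_right hw0
  have hlast : w (Fin.last n) = μ ^ n * w 0 := hrow n (by omega)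
  have hs : ∑ j : Fin (n + 1), ((-Λ.coeff j : ℝ) : ℂ) * w j
      = -((∑ j : Fin (n + 1), (Λ.coeff j : ℂ) * μ ^ (j : ℕ)) * w 0) := by
    rw [Finset.sum_mul, ← Finset.sum_neg_distrib]
    refine Finset.sum_congr rfl fun j _ => ?_
    rw [show w j = μ ^ (j : ℕ) * w 0 from hrow j j.2]
    push_cast
    ring
  rw [hs, hlast] at h
  linear_combination -h

theorem isSchur_internalG1 {n m p : ℕ} {F Aε : Matrix (Fin n) (Fin n) ℝ} (hF : IsSchur F)
    (hAε : Aε.charpoly = F.charpoly) : IsSchur (internalG1 n m p F.charpoly Aε) := by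
  have hroots := isSchur_of_roots.1 hF
  have hc : IsSchur (companionMat n F.charpoly) :=
    isSchur_companionMat F.charpoly_monic (by simp) hroots
  have hε : IsSchur Aε := isSchur_of_roots.2 (by rwa [hAε])
  exact (hc.one_kronecker.fromBlocks (hc.one_kronecker.fromBlocks hε)).submatrix_equiv _

/-! ## The parameterization matrix -/

theorem coeff_charmatrix_mulVec {n : ℕ} (F : Matrix (Fin n) (Fin n) ℝ)
    (w : Fin n → Polynomial ℝ) (i : Fin n) :
    (F.charmatrix *ᵥ w) i = Polynomial.X * w i - ∑ j, Polynomial.C (F i j) * w j := by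
  simp only [Matrix.mulVec, dotProduct, Matrix.charmatrix_apply, sub_mul, Finset.sum_sub_distrib]
  simp [Matrix.diagonal_apply, ite_mul]

/-- The coefficient of `zᵏ` in `adj(z I - F) v`. -/
def numeratorCoeff {n : ℕ} (F : Matrix (Fin n) (Fin n) ℝ) (v : Fin n → ℝ) (k : ℕ) : Fin n → ℝ :=
  fun i => ((F.charmatrix.adjugate *ᵥ fun a => Polynomial.C (v a)) i).coeff k

theorem charmatrix_mulVec_adjugate {n : ℕ} (F : Matrix (Fin n) (Fin n) ℝ) (v : Fin n → ℝ)
    (i : Fin n) :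
    (F.charmatrix *ᵥ (F.charmatrix.adjugate *ᵥ fun a => Polynomial.C (v a))) i
      = F.charpoly * Polynomial.C (v i) := by
  rw [Matrix.mulVec_mulVec, Matrix.mul_adjugate, Matrix.smul_mulVec, Matrix.one_mulVec]
  rfl

/-- Here and in `numeratorCoeff_succ`, coefficients are compared in `(zI - F) adj(zI - F) v = Λ(z)
v`. -/
theorem numeratorCoeff_zero {n : ℕ} (F : Matrix (Fin n) (Fin n) ℝ) (v : Fin n → ℝ) :
    F *ᵥ numeratorCoeff F v 0 = -(F.charpoly.coeff 0 • v) := by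
  ext i
  have h := congrArg (Polynomial.coeff · 0) (charmatrix_mulVec_adjugate F v i)
  rw [coeff_charmatrix_mulVec] at h
  simp only [Polynomial.coeff_sub, Polynomial.coeff_X_mul_zero, Polynomial.finsetSum_coeff,
    Polynomial.coeff_C_mul, Polynomial.coeff_mul_C, zero_sub] at h
  simp only [Pi.neg_apply, Pi.smul_apply, smul_eq_mul, ← h, neg_neg]
  rfl

theorem numeratorCoeff_succ {n : ℕ} (F : Matrix (Fin n) (Fin n) ℝ) (v : Fin n → ℝ) (k : ℕ) :
    F *ᵥ numeratorCoeff F v (k + 1) = numeratorCoeff F v k - F.charpoly.coeff (k + 1) • v := by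
  ext i
  have h := congrArg (Polynomial.coeff · (k + 1)) (charmatrix_mulVec_adjugate F v i)
  rw [coeff_charmatrix_mulVec] at h
  simp only [Polynomial.coeff_sub, Polynomial.coeff_X_mul, Polynomial.finsetSum_coeff,
    Polynomial.coeff_C_mul, Polynomial.coeff_mul_C] at h
  simp only [Pi.sub_apply, Pi.smul_apply, smul_eq_mul, ← h, numeratorCoeff, Matrix.mulVec,
    dotProduct]
  ring

theorem numeratorCoeff_eq_zero {n : ℕ} (F : Matrix (Fin n) (Fin n) ℝ) (v : Fin n → ℝ) (k : ℕ)
    (hk : n ≤ k) : numeratorCoeff F v k = 0 := by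
  have hdeg : F.charpoly.natDegree = n := by simp
  obtain ⟨d, hd⟩ : ∃ d, ∀ l ≥ d, numeratorCoeff F v l = 0 := by
    refine ⟨Finset.univ.sup (fun i =>
      ((F.charmatrix.adjugate *ᵥ fun a => Polynomial.C (v a)) i).natDegree) + 1,
      fun l hl => funext fun i => Polynomial.coeff_eq_zero_of_natDegree_lt ?_⟩
    have := Finset.le_sup (f := fun i =>
      ((F.charmatrix.adjugate *ᵥ fun a => Polynomial.C (v a)) i).natDegree) (Finset.mem_univ i)
    omega
  -- Above degree `n` the characteristic polynomial has no coefficients, so the recursion carries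
  -- vanishing downwards from `d` to `n`.
  have hback : ∀ t l, n ≤ l → d ≤ l + t → numeratorCoeff F v l = 0 := by
    intro t
    induction t with
    | zero => exact fun l _ hl => hd l hl
    | succ t ih =>
      intro l hl hlt
      have h := numeratorCoeff_succ F v l
      rw [ih (l + 1) (by omega) (by omega), Matrix.mulVec_zero,
        Polynomial.coeff_eq_zero_of_natDegree_lt (by omega), zero_smul, sub_zero] at h
      exact h.symm
  exact hback d k hk (by omega)

theorem numeratorCoeff_last {n : ℕ} (F : Matrix (Fin (n + 1)) (Fin (n + 1)) ℝ)
    (v : Fin (n + 1) → ℝ) : numeratorCoeff F v n = v := by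
  have h := numeratorCoeff_succ F v n
  have hc : F.charpoly.coeff (n + 1) = 1 := by
    have := F.charpoly_monic.coeff_natDegree
    simpa using this
  rw [numeratorCoeff_eq_zero F v (n + 1) le_rfl, Matrix.mulVec_zero, hc, one_smul] at h
  exact (sub_eq_zero.1 h.symm)

theorem numeratorMat_mul_lastCol {n : ℕ} (F : Matrix (Fin n) (Fin n) ℝ) (v : Fin n → ℝ)
    (i : Fin n) (j : Fin 1) : (numeratorMat F v * lastCol n) i j = v i := by
  obtain _ | n := n
  · exact i.elim0
  rw [Matrix.mul_apply, Finset.sum_eq_single (Fin.last n)]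
  · have : numeratorMat F v i (Fin.last n) = v i := congrFun (numeratorCoeff_last F v) i
    simp [lastCol, this]
  · intro l _ hl
    have : (l : ℕ) ≠ n := fun h => hl (Fin.ext h)
    simp [lastCol, this]
  · simp

/-- Read columnwise, this is the coefficient recursion; the last column equals `v`, which accounts
for the last row of the companion matrix. -/
theorem numeratorMat_mul_companionMat {n : ℕ} (F : Matrix (Fin n) (Fin n) ℝ) (v : Fin n → ℝ) :
    numeratorMat F v * companionMat n F.charpoly = F * numeratorMat F v := by
  obtain _ | n := n
  · exact Subsingleton.elim _ _
  ext i l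
  have hR : (F * numeratorMat F v) i l = (F *ᵥ numeratorCoeff F v l) i := rfl
  have hlast : numeratorMat F v i (Fin.last n) = v i := congrFun (numeratorCoeff_last F v) i
  rw [hR, Matrix.mul_apply, Fin.sum_univ_castSucc, hlast]
  have hc : ∀ k : Fin n, companionMat (n + 1) F.charpoly k.castSucc l
      = if (l : ℕ) = k + 1 then 1 else 0 := fun k => by
    have : (k : ℕ) ≠ n := k.2.ne
    simp [companionMat, this]
  have hcl : companionMat (n + 1) F.charpoly (Fin.last n) l = -F.charpoly.coeff l := by
    simp [companionMat]
  simp only [hc, hcl]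
  obtain rfl | ⟨l, rfl⟩ := Fin.eq_zero_or_eq_succ l
  · simp [numeratorCoeff_zero, mul_comm]
  · rw [Fin.val_succ, numeratorCoeff_succ, Finset.sum_eq_single l]
    · simp only [if_true, mul_one, Pi.sub_apply, Pi.smul_apply, smul_eq_mul]
      rw [show numeratorMat F v i l.castSucc = numeratorCoeff F v l i from rfl]
      ring
    · intro k _ hk
      have : (l : ℕ) ≠ k := fun h => hk (Fin.ext h.symm)
      simp [this]
    · simp

theorem blockRow_mul_one_kronecker {n k q : ℕ} (N : Fin k → Matrix (Fin n) (Fin n) ℝ)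
    (T : Matrix (Fin n) (Fin q) ℝ) :
    (Matrix.of fun r (c : Fin k × Fin n) => N c.1 r c.2) * ((1 : Matrix (Fin k) (Fin k) ℝ) ⊗ₖ T)
      = Matrix.of fun r (c : Fin k × Fin q) => (N c.1 * T) r c.2 := by
  ext r ⟨c, l⟩
  simp [Matrix.mul_apply, Fintype.sum_prod_type, Matrix.one_apply, ite_mul]

section

variable {n m p : ℕ} (A : Matrix (Fin n) (Fin n) ℝ) (B : Matrix (Fin n) (Fin m) ℝ)
  (C : Matrix (Fin p) (Fin n) ℝ) (L : Matrix (Fin n) (Fin p) ℝ) (x₀ : Fin n → ℝ)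
  {Aε : Matrix (Fin n) (Fin n) ℝ} {ηε₀ : Fin n → ℝ}

theorem paramMat_mul_internalG1 (hAε : Aε.charpoly = (A - L * C).charpoly)
    (hηε₀ : IsUnit (numeratorMat Aε ηε₀).det) :
    paramMat A B C L x₀ Aε ηε₀ * internalG1 n m p (A - L * C).charpoly Aε
      = (A - L * C) * paramMat A B C L x₀ Aε ηε₀ := by
  have hε : numeratorMat (A - L * C) x₀ * (numeratorMat Aε ηε₀)⁻¹ * Aε
      = (A - L * C) * (numeratorMat (A - L * C) x₀ * (numeratorMat Aε ηε₀)⁻¹) := by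
    -- `Aε` and `A - L * C` share a characteristic polynomial, so one companion matrix links both.
    have h1 := numeratorMat_mul_companionMat Aε ηε₀
    rw [hAε] at h1
    have h2 : (numeratorMat Aε ηε₀)⁻¹ * Aε
        = companionMat n (A - L * C).charpoly * (numeratorMat Aε ηε₀)⁻¹ := by
      rw [← Matrix.mul_one ((numeratorMat Aε ηε₀)⁻¹ * Aε), ← Matrix.mul_nonsing_inv _ hηε₀,
        ← Matrix.mul_assoc, Matrix.mul_assoc _ Aε, ← h1, ← Matrix.mul_assoc,
        Matrix.nonsing_inv_mul _ hηε₀, Matrix.one_mul]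
    rw [← Matrix.mul_assoc (A - L * C), ← numeratorMat_mul_companionMat, Matrix.mul_assoc, h2,
      Matrix.mul_assoc]
  have hblk : ∀ {k : ℕ} (v : Fin k → Fin n → ℝ),
      (Matrix.of fun r (c : Fin k × Fin n) => numeratorMat (A - L * C) (v c.1) r c.2)
        * ((1 : Matrix (Fin k) (Fin k) ℝ) ⊗ₖ companionMat n (A - L * C).charpoly)
      = (A - L * C) * Matrix.of fun r (c : Fin k × Fin n) =>
          numeratorMat (A - L * C) (v c.1) r c.2 := by
    intro k v
    rw [blockRow_mul_one_kronecker fun c => numeratorMat (A - L * C) (v c)]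
    simp only [numeratorMat_mul_companionMat]
    rfl
  rw [paramMat, internalG1, Matrix.submatrix_mul_equiv, Matrix.fromCols_mul_fromBlocks,
    Matrix.fromCols_mul_fromBlocks, hblk fun c a => B a c, hblk fun c a => L a c, hε]
  simp only [Matrix.mul_zero, add_zero, zero_add]
  rw [← Matrix.mul_fromCols, ← Matrix.mul_fromCols]
  rfl

theorem paramMat_mulVec_internalG2 (u : Fin m → ℝ) (y : Fin p → ℝ) :
    paramMat A B C L x₀ Aε ηε₀ *ᵥ (internalG2 n m p *ᵥ zetaVec u y) = B *ᵥ u + L *ᵥ y := by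
  have hblk : ∀ {k : ℕ} (V : Matrix (Fin n) (Fin k) ℝ),
      (Matrix.of fun r (c : Fin k × Fin n) => numeratorMat (A - L * C) (fun a => V a c.1) r c.2)
        * ((1 : Matrix (Fin k) (Fin k) ℝ) ⊗ₖ lastCol n)
      = Matrix.of fun r (c : Fin k × Fin 1) => V r c.1 := by
    intro k V
    rw [blockRow_mul_one_kronecker fun c => numeratorMat (A - L * C) (fun a => V a c)]
    ext r c
    simp [numeratorMat_mul_lastCol]
  rw [Matrix.mulVec_mulVec, paramMat, internalG2, Matrix.submatrix_mul_equiv,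
    Matrix.fromCols_mul_fromBlocks, Matrix.fromCols_mul_fromBlocks, hblk B, hblk L]
  ext r
  simp [Matrix.mulVec, dotProduct, zetaVec, Fintype.sum_prod_type]

/-- Each numerator matrix sends `b` to its own vector, so the last block takes `ηε₀` to `b` and then
to `x₀`. -/
theorem paramMat_mulVec_etaInit (hηε₀ : IsUnit (numeratorMat Aε ηε₀).det) :
    paramMat A B C L x₀ Aε ηε₀ *ᵥ etaInit n m p ηε₀ = x₀ := by
  have hN : ∀ (F : Matrix (Fin n) (Fin n) ℝ) v,
      numeratorMat F v *ᵥ (fun i => lastCol n i 0) = v := fun F v =>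
    funext fun i => numeratorMat_mul_lastCol F v i 0
  have hε : (numeratorMat (A - L * C) x₀ * (numeratorMat Aε ηε₀)⁻¹) *ᵥ ηε₀ = x₀ := by
    have h1 : (numeratorMat Aε ηε₀)⁻¹ *ᵥ ηε₀ = fun i => lastCol n i 0 := by
      have h2 := congrArg ((numeratorMat Aε ηε₀)⁻¹ *ᵥ ·) (hN Aε ηε₀)
      simp only [Matrix.mulVec_mulVec, Matrix.nonsing_inv_mul _ hηε₀, Matrix.one_mulVec] at h2
      exact h2.symm
    rw [← Matrix.mulVec_mulVec, h1, hN]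
  rw [paramMat, etaInit, Matrix.submatrix_mulVec_equiv]
  have hz : ∀ {k : ℕ} (X : Matrix (Fin n) (Fin k × Fin n) ℝ), X *ᵥ (fun _ => 0) = 0 := fun X =>
    X.mulVec_zero
  ext r
  simp [Matrix.fromCols_mulVec, Function.comp_def, hε, hz]

end

/-! ## Data regressors -/

theorem deltaQuad_dotProduct_vech {N : ℕ} {S : Matrix (Fin N) (Fin N) ℝ} (hS : S.IsSymm)
    (v : Fin N → ℝ) : deltaQuad v ⬝ᵥ vech S = quad S v := by
  have hsymm : ∀ i j, S j i = S i j := fun i j => hS.apply i j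
  have hL : deltaQuad v ⬝ᵥ vech S = ∑ i, ∑ j, if i ≤ j then
      (2 * (v i * v j) - if i = j then v i ^ 2 else 0) * S i j else 0 := by
    rw [← Fintype.sum_prod_type' (f := fun i j => if i ≤ j then
      (2 * (v i * v j) - if i = j then v i ^ 2 else 0) * S i j else 0), ← Finset.sum_filter,
      dotProduct, Finset.sum_subtype (p := fun q : Fin N × Fin N => q.1 ≤ q.2) _ (by simp)]
    refine Finset.sum_congr rfl fun q _ => ?_
    simp [deltaQuad, vech, Matrix.vecMulVec_apply, Matrix.diagonal_pow, Matrix.diagonal_apply]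
  -- Fold the strict lower triangle onto the upper one, so that off-diagonal terms count twice and
  -- diagonal terms once.
  have hR : quad S v = ∑ i, ∑ j, ((if i ≤ j then v i * S i j * v j else 0)
      + if i < j then v i * S i j * v j else 0) := by
    have h1 : ∑ i, ∑ j, (if i < j then v i * S i j * v j else 0)
        = ∑ i, ∑ j, if j < i then v i * S i j * v j else 0 := by
      rw [Finset.sum_comm]
      refine Finset.sum_congr rfl fun i _ => Finset.sum_congr rfl fun j _ => ?_
      rw [hsymm i j]
      congr 1
      ring
    simp only [Finset.sum_add_distrib]
    rw [h1]
    simp only [← Finset.sum_add_distrib, quad, Matrix.mulVec, dotProduct, Finset.mul_sum]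
    refine Finset.sum_congr rfl fun i _ => Finset.sum_congr rfl fun j _ => ?_
    by_cases h : i ≤ j
    · simp [h, h.not_gt, mul_assoc]
    · simp [h, not_le.1 h, mul_assoc]
  rw [hL, hR]
  refine Finset.sum_congr rfl fun i _ => Finset.sum_congr rfl fun j _ => ?_
  rcases lt_trichotomy i j with h | rfl | h
  · simp only [h.le, h, h.ne, if_true, if_false]
    ring
  · simp only [le_refl, lt_irrefl, if_true, if_false]
    ring
  · simp [h.not_ge, h.not_gt]

theorem deltaBilin_dotProduct_vec {N m : ℕ} (v : Fin N → ℝ) (w : Fin m → ℝ)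
    (T : Matrix (Fin N) (Fin m) ℝ) : deltaBilin v w ⬝ᵥ T.vec = v ⬝ᵥ T *ᵥ w := by
  simp only [deltaBilin, dotProduct, Matrix.mulVec, Matrix.vec, Fintype.sum_prod_type,
    Finset.mul_sum]
  rw [Finset.sum_comm]
  exact Finset.sum_congr rfl fun i _ => Finset.sum_congr rfl fun j _ => by ring

theorem dataPi_mulVec {N m : ℕ} (η : ℕ → Fin N → ℝ) (u : ℕ → Fin m → ℝ) (kN : ℕ)
    {X : Matrix (Fin N) (Fin N) ℝ} (Y : Matrix (Fin N) (Fin m) ℝ) {Z : Matrix (Fin m) (Fin m) ℝ}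
    (hX : X.IsSymm) (hZ : Z.IsSymm) (k : Fin (kN + 1)) :
    (dataPi η u kN *ᵥ Sum.elim (vech X) (Sum.elim Y.vec (vech Z))) k
      = quad X (η k) + 2 * (η k ⬝ᵥ Y *ᵥ u k) + quad Z (u k) := by
  have : (dataPi η u kN *ᵥ Sum.elim (vech X) (Sum.elim Y.vec (vech Z))) k
      = Sum.elim (deltaQuad (η k)) (Sum.elim ((2 : ℝ) • deltaBilin (η k) (u k))
          (deltaQuad (u k))) ⬝ᵥ Sum.elim (vech X) (Sum.elim Y.vec (vech Z)) := rfl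
  rw [this, sumElim_dotProduct_sumElim, sumElim_dotProduct_sumElim,
    deltaQuad_dotProduct_vech hX, deltaQuad_dotProduct_vech hZ, smul_dotProduct,
    deltaBilin_dotProduct_vec, smul_eq_mul, add_assoc]

theorem card_upperIdx (N : ℕ) : 2 * Fintype.card (UpperIdx N) = N * (N + 1) := by
  have h : Fintype.card (UpperIdx N) = ∑ j : Fin N, ((j : ℕ) + 1) := by
    rw [Fintype.card_subtype, Finset.card_filter, Fintype.sum_prod_type_right]
    refine Finset.sum_congr rfl fun j _ => ?_
    rw [← Finset.card_filter, Finset.filter_ge_eq_Iic, Fin.card_Iic]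
  rw [h, Fin.sum_univ_eq_sum_range (fun j => j + 1)]
  have h2 := Finset.sum_range_id_mul_two (N + 1)
  rw [Finset.sum_range_succ'] at h2
  simp only [add_zero, Nat.add_sub_cancel] at h2
  linarith

/-- Identifies the prescribed rank with the number of unknowns, that is, with full column rank. -/
theorem card_unknownIdx (N m : ℕ) :
    Fintype.card (UnknownIdx N m) = (N + m) * (N + m + 1) / 2 := by
  have h : 2 * Fintype.card (UnknownIdx N m) = (N + m) * (N + m + 1) := by
    have h1 := card_upperIdx N
    have h2 := card_upperIdx m
    simp only [Fintype.card_sum, Fintype.card_prod, Fintype.card_fin]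
    linarith
  omega

theorem Matrix.mulVec_injective_of_rank_eq_card {ι κ : Type*} [Fintype ι] [Fintype κ]
    (M : Matrix ι κ ℝ) (h : M.rank = Fintype.card κ) : Function.Injective (M *ᵥ ·) := by
  classical
  have h1 := M.mulVecLin.finrank_range_add_finrank_ker
  rw [← Matrix.rank, h, Module.finrank_fintype_fun_eq_card] at h1
  have h2 : LinearMap.ker M.mulVecLin = ⊥ := Submodule.finrank_eq_zero.1 (by omega)
  exact LinearMap.ker_eq_bot.1 h2

theorem vech_injective {N : ℕ} {S T : Matrix (Fin N) (Fin N) ℝ} (hS : S.IsSymm) (hT : T.IsSymm)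
    (h : vech S = vech T) : S = T := by
  ext i j
  rcases le_total i j with hij | hij
  · exact congrFun h ⟨(i, j), hij⟩
  · rw [← hS.apply, ← hT.apply]
    exact congrFun h ⟨(j, i), hij⟩

/-! ## The learned quantities -/

/-- The model-based quantities of one iteration of value iteration. -/
def modelIterate {N m : ℕ} (𝒜 : Matrix (Fin N) (Fin N) ℝ) (𝓑 : Matrix (Fin N) (Fin m) ℝ)
    (Q : Matrix (Fin N) (Fin N) ℝ) (R : Matrix (Fin m) (Fin m) ℝ) (X : Matrix (Fin N) (Fin N) ℝ) :
    VIIterate N m :=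
  ⟨X, 𝒜ᵀ * X * 𝒜 + Q, 𝒜ᵀ * X * 𝓑, R + 𝓑ᵀ * X * 𝓑⟩

section

variable {N m : ℕ} {𝒜 : Matrix (Fin N) (Fin N) ℝ} {𝓑 : Matrix (Fin N) (Fin m) ℝ}
  {Q : Matrix (Fin N) (Fin N) ℝ} {R : Matrix (Fin m) (Fin m) ℝ} {X : Matrix (Fin N) (Fin N) ℝ}
  {η : ℕ → Fin N → ℝ} {u : ℕ → Fin m → ℝ} {kN : ℕ} {ℒ : Fin (kN + 1) → ℝ}

theorem modelIterate_gain (hX : X.PosSemidef) :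
    (modelIterate 𝒜 𝓑 Q R X).gain = stateGain 𝒜 𝓑 R X := by
  simp only [VIIterate.gain, modelIterate, stateGain, Matrix.transpose_mul,
    Matrix.transpose_transpose, hX.transpose_eq, Matrix.mul_assoc]

theorem modelIterate_update (hX : X.PosSemidef) :
    (modelIterate 𝒜 𝓑 Q R X).Pηη - (modelIterate 𝒜 𝓑 Q R X).Pηu
      * (modelIterate 𝒜 𝓑 Q R X).Puu⁻¹ * (modelIterate 𝒜 𝓑 Q R X).Pηuᵀ
      = riccatiMap 𝒜 𝓑 Q R X := by
  simp only [modelIterate, riccatiMap, Matrix.transpose_mul,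
    Matrix.transpose_transpose, hX.transpose_eq, Matrix.mul_assoc]

theorem modelIterate_isSymm (hQ : Q.PosSemidef) (hR : R.PosDef) (hX : X.PosSemidef) :
    (modelIterate 𝒜 𝓑 Q R X).Pηη.IsSymm ∧ (modelIterate 𝒜 𝓑 Q R X).Puu.IsSymm :=
  ⟨((hX.transpose_mul_mul_same 𝒜).add hQ).transpose_eq,
    (posDef_inputWeight hR hX).posSemidef.transpose_eq⟩

theorem quad_mulVec_add_mulVec (hX : X.PosSemidef) (v : Fin N → ℝ) (w : Fin m → ℝ) :
    quad X (𝒜 *ᵥ v + 𝓑 *ᵥ w)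
      = quad (𝒜ᵀ * X * 𝒜) v + 2 * (v ⬝ᵥ (𝒜ᵀ * X * 𝓑) *ᵥ w) + quad (𝓑ᵀ * X * 𝓑) w := by
  have h1 : v ⬝ᵥ (𝒜ᵀ * X * 𝓑) *ᵥ w = (𝒜 *ᵥ v) ⬝ᵥ X *ᵥ (𝓑 *ᵥ w) := by
    rw [← Matrix.mulVec_mulVec, ← Matrix.mulVec_mulVec, Matrix.dotProduct_mulVec,
      Matrix.vecMul_transpose]
  have hcomm : ∀ a b, a ⬝ᵥ X *ᵥ b = b ⬝ᵥ X *ᵥ a := fun a b => by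
    rw [Matrix.dotProduct_mulVec, ← Matrix.mulVec_transpose, hX.transpose_eq, dotProduct_comm]
  rw [quad_conj X, quad_conj X, h1]
  simp only [quad, Matrix.mulVec_add, dotProduct_add, add_dotProduct,
    hcomm (𝓑 *ᵥ w) (𝒜 *ᵥ v)]
  ring

/-- Each data row is the expansion of `quad X (η (k + 1))` along the dynamics, plus the stage cost.
-/
theorem modelIterate_learned (hQ : Q.PosSemidef) (hR : R.PosDef) (hX : X.PosSemidef)
    (hη : ∀ k, η (k + 1) = 𝒜 *ᵥ η k + 𝓑 *ᵥ u k)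
    (hcost : ∀ k : Fin (kN + 1), ℒ k = quad Q (η k) + quad R (u k)) :
    (modelIterate 𝒜 𝓑 Q R X).Learned (dataPi η u kN) (dataPsi η kN) ℒ := by
  obtain ⟨h1, h2⟩ := modelIterate_isSymm (𝒜 := 𝒜) (𝓑 := 𝓑) hQ hR hX
  refine ⟨h1, h2, funext fun k => ?_⟩
  rw [dataPi_mulVec η u kN _ h1 h2, Pi.add_apply, hcost]
  have : (dataPsi η kN *ᵥ vech (modelIterate 𝒜 𝓑 Q R X).P) k = quad X (η (k + 1)) :=
    deltaQuad_dotProduct_vech hX.transpose_eq _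
  rw [this, hη, quad_mulVec_add_mulVec hX]
  simp only [modelIterate, quad_add]
  ring

theorem eq_modelIterate_of_learned (hQ : Q.PosSemidef) (hR : R.PosDef) (hX : X.PosSemidef)
    (hη : ∀ k, η (k + 1) = 𝒜 *ᵥ η k + 𝓑 *ᵥ u k)
    (hcost : ∀ k : Fin (kN + 1), ℒ k = quad Q (η k) + quad R (u k))
    (hData : (dataPi η u kN).rank = (N + m) * (N + m + 1) / 2) {s : VIIterate N m}
    (hs : s.Learned (dataPi η u kN) (dataPsi η kN) ℒ) (hP : s.P = X) :
    s = modelIterate 𝒜 𝓑 Q R X := by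
  subst hP
  obtain ⟨h1, h2, h3⟩ := modelIterate_learned hQ hR hX hη hcost
  obtain ⟨g1, g2, g3⟩ := hs
  have hinj := Matrix.mulVec_injective_of_rank_eq_card _ (hData.trans (card_unknownIdx N m).symm)
  have h := hinj (h3.trans g3.symm)
  obtain ⟨e1, e2⟩ := Sum.elim_eq_iff.1 h
  obtain ⟨e2, e3⟩ := Sum.elim_eq_iff.1 e2
  have e1 := vech_injective h1 g1 e1
  have e2 := Matrix.vec_inj.1 e2
  have e3 := vech_injective h2 g2 e3
  cases s
  simp only [modelIterate, VIIterate.mk.injEq] at *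
  exact ⟨trivial, e1.symm, e2.symm, e3.symm⟩

/-- With data of full rank, the only run of the model-free value iteration is the model-based
value iteration. -/
theorem isVIRun_iff (hQ : Q.PosSemidef) (hR : R.PosDef) (hX : X.PosSemidef)
    (hη : ∀ k, η (k + 1) = 𝒜 *ᵥ η k + 𝓑 *ᵥ u k)
    (hcost : ∀ k : Fin (kN + 1), ℒ k = quad Q (η k) + quad R (u k))
    (hData : (dataPi η u kN).rank = (N + m) * (N + m + 1) / 2) (s : ℕ → VIIterate N m) :
    IsVIRun (dataPi η u kN) (dataPsi η kN) ℒ X s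
      ↔ s = fun j => modelIterate 𝒜 𝓑 Q R ((riccatiMap 𝒜 𝓑 Q R)^[j] X) := by
  have hpsd := riccatiMap_iterate_posSemidef (A := 𝒜) (B := 𝓑) hQ hR hX
  constructor
  · rintro ⟨h0, hs⟩
    funext j
    -- Only the component `P` needs induction; uniqueness of the learned blocks gives the rest.
    refine eq_modelIterate_of_learned hQ hR (hpsd j) hη hcost hData (hs j).1 ?_
    induction j with
    | zero => exact h0
    | succ j ih =>
      rw [(hs j).2, eq_modelIterate_of_learned hQ hR (hpsd j) hη hcost hData (hs j).1 ih,
        modelIterate_update (hpsd j), Function.iterate_succ_apply']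
  · rintro rfl
    refine ⟨rfl, fun j => ⟨modelIterate_learned hQ hR (hpsd j) hη hcost, ?_⟩⟩
    rw [modelIterate_update (hpsd j), ← Function.iterate_succ_apply' (riccatiMap 𝒜 𝓑 Q R)]
    rfl

end

/-! ## Systems that project onto another system -/

section

variable {n N m : ℕ} {A : Matrix (Fin n) (Fin n) ℝ} {B : Matrix (Fin n) (Fin m) ℝ}
  {R : Matrix (Fin m) (Fin m) ℝ} {𝒜 : Matrix (Fin N) (Fin N) ℝ} {𝓑 : Matrix (Fin N) (Fin m) ℝ}
  {M : Matrix (Fin n) (Fin N) ℝ}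

theorem stateGain_pullback (hA : M * 𝒜 = A * M) (hB : M * 𝓑 = B) (X : Matrix (Fin n) (Fin n) ℝ) :
    stateGain 𝒜 𝓑 R (Mᵀ * X * M) = stateGain A B R X * M := by
  subst hB
  simp only [stateGain, Matrix.transpose_mul, Matrix.mul_assoc, hA]

/-- Costs that depend on the lifted state only through its image under `M` keep this form, because
that image evolves by `A` and `B`. -/
theorem riccatiMap_pullback (hA : M * 𝒜 = A * M) (hB : M * 𝓑 = B)
    (Q X : Matrix (Fin n) (Fin n) ℝ) :
    riccatiMap 𝒜 𝓑 (Mᵀ * Q * M) R (Mᵀ * X * M) = Mᵀ * riccatiMap A B Q R X * M := by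
  have hAt : 𝒜ᵀ * Mᵀ = Mᵀ * Aᵀ := by rw [← Matrix.transpose_mul, hA, Matrix.transpose_mul]
  have hAt' : ∀ {q : ℕ} (Z : Matrix (Fin n) (Fin q) ℝ), 𝒜ᵀ * (Mᵀ * Z) = Mᵀ * (Aᵀ * Z) := fun Z => by
    rw [← Matrix.mul_assoc, hAt, Matrix.mul_assoc]
  subst hB
  simp only [riccatiMap, Matrix.transpose_mul, Matrix.mul_assoc, hA, hAt', Matrix.mul_add,
    Matrix.add_mul, Matrix.mul_sub, Matrix.sub_mul]

theorem riccatiMap_iterate_pullback (hA : M * 𝒜 = A * M) (hB : M * 𝓑 = B)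
    (Q X : Matrix (Fin n) (Fin n) ℝ) (j : ℕ) :
    (riccatiMap 𝒜 𝓑 (Mᵀ * Q * M) R)^[j] (Mᵀ * X * M)
      = Mᵀ * (riccatiMap A B Q R)^[j] X * M := by
  induction j with
  | zero => rfl
  | succ j ih =>
    rw [Function.iterate_succ_apply', Function.iterate_succ_apply', ih, riccatiMap_pullback hA hB]

theorem tendsto_pullback {X : ℕ → Matrix (Fin n) (Fin n) ℝ} {P : Matrix (Fin n) (Fin n) ℝ}
    (M : Matrix (Fin n) (Fin N) ℝ) (h : Tendsto X atTop (𝓝 P)) :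
    Tendsto (fun j => Mᵀ * X j * M) atTop (𝓝 (Mᵀ * P * M)) := by
  have hc : Continuous fun Z : Matrix (Fin n) (Fin n) ℝ => Mᵀ * Z * M := by fun_prop
  exact (hc.tendsto P).comp h

end

/-! ## The internal model in closed form -/

/-- The embedding of the input into `ζ = col(u, y, 0)`. -/
def zetaInput (m p : ℕ) : Matrix ((Fin m × Fin 1) ⊕ ((Fin p × Fin 1) ⊕ Fin 1)) (Fin m) ℝ :=
  Matrix.of fun c j => zetaVec (p := p) (Pi.single j 1) 0 c

/-- The embedding of the output into `ζ = col(u, y, 0)`. -/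
def zetaOutput (m p : ℕ) : Matrix ((Fin m × Fin 1) ⊕ ((Fin p × Fin 1) ⊕ Fin 1)) (Fin p) ℝ :=
  Matrix.of fun c j => zetaVec (m := m) 0 (Pi.single j 1) c

theorem zetaInput_mulVec {m p : ℕ} (u : Fin m → ℝ) :
    zetaInput m p *ᵥ u = zetaVec u (0 : Fin p → ℝ) := by
  ext (c | c | c) <;> simp [zetaInput, zetaVec, Matrix.mulVec, dotProduct, Pi.single_apply]

theorem zetaOutput_mulVec {m p : ℕ} (y : Fin p → ℝ) :
    zetaOutput m p *ᵥ y = zetaVec (0 : Fin m → ℝ) y := by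
  ext (c | c | c) <;> simp [zetaOutput, zetaVec, Matrix.mulVec, dotProduct, Pi.single_apply]

theorem zetaVec_eq {m p : ℕ} (u : Fin m → ℝ) (y : Fin p → ℝ) :
    zetaVec u y = zetaInput m p *ᵥ u + zetaOutput m p *ᵥ y := by
  rw [zetaInput_mulVec, zetaOutput_mulVec]
  ext (c | c | c) <;> simp [zetaVec]

end

/-! ### Convergence of the learned gains -/

theorem theorem4 {n m p : ℕ}
    (A : Matrix (Fin n) (Fin n) ℝ) (B : Matrix (Fin n) (Fin m) ℝ) (C : Matrix (Fin p) (Fin n) ℝ)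
    (hAB : Stabilizable A B) (hAC : Observable A C)
    (Qy : Matrix (Fin p) (Fin p) ℝ) (R : Matrix (Fin m) (Fin m) ℝ)
    (hQy : Qy.PosSemidef) (hR : R.PosDef)
    (S : Matrix (Fin n) (Fin n) ℝ) (hS : IsPSDSqrt S (Cᵀ * Qy * C)) (hAS : Observable A S)
    -- the observer gain and the user-defined part of the internal model
    (L : Matrix (Fin n) (Fin p) ℝ) (Aε : Matrix (Fin n) (Fin n) ℝ) (ηε₀ : Fin n → ℝ)
    (hAε : Aε.charpoly = (A - L * C).charpoly) (hηε₀ : IsUnit (numeratorMat Aε ηε₀).det)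
    -- a trajectory of the plant and of the internal model
    (x : ℕ → Fin n → ℝ) (u : ℕ → Fin m → ℝ) (y : ℕ → Fin p → ℝ)
    (η : ℕ → Fin (dimEta n m p) → ℝ)
    (hx : ∀ k, x (k + 1) = A *ᵥ x k + B *ᵥ u k) (hy : ∀ k, y k = C *ᵥ x k)
    (hη₀ : η 0 = etaInit n m p ηε₀)
    (hη : ∀ k, η (k + 1) = internalG1 n m p (A - L * C).charpoly Aε *ᵥ η k
      + internalG2 n m p *ᵥ zetaVec (u k) (y k))
    -- the two rank conditions
    (kN : ℕ)
    (hData : (dataPi η u kN).rank = (dimEta n m p + m) * (dimEta n m p + m + 1) / 2)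
    (hM : (paramMat A B C L (x 0) Aε ηε₀).rank = n)
    -- the initial value matrix
    (P₀ : Matrix (Fin (dimEta n m p)) (Fin (dimEta n m p)) ℝ) (hP₀ : P₀.PosSemidef)
    (hstable : IsSchur (A - L * C) ∨
      ∃ X : Matrix (Fin n) (Fin n) ℝ, X.PosSemidef ∧
        P₀ = (paramMat A B C L (x 0) Aε ηε₀)ᵀ * X * paramMat A B C L (x 0) Aε ηε₀) :
    ∃ Pstar : Matrix (Fin n) (Fin n) ℝ,
      (Pstar.PosSemidef ∧ IsRiccatiSolution A B (Cᵀ * Qy * C) R Pstar) ∧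
      (∀ P : Matrix (Fin n) (Fin n) ℝ,
        P.PosSemidef → IsRiccatiSolution A B (Cᵀ * Qy * C) R P → P = Pstar) ∧
      (∃! s : ℕ → VIIterate (dimEta n m p) m,
        IsVIRun (dataPi η u kN) (dataPsi η kN) (dataCost y u Qy R kN) P₀ s) ∧
      ∀ s : ℕ → VIIterate (dimEta n m p) m,
        IsVIRun (dataPi η u kN) (dataPsi η kN) (dataCost y u Qy R kN) P₀ s →
        (∀ j, IsUnit (s j).Puu.det) ∧
        Tendsto (fun j => (s j).gain) atTop
          (𝓝 (stateGain A B R Pstar * paramMat A B C L (x 0) Aε ηε₀)) := by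
  have hQ : (Cᵀ * Qy * C).PosSemidef := hQy.transpose_mul_mul_same C
  obtain ⟨P, hlim⟩ := exists_tendsto_riccatiMap_iterate_zero hAB hQ hR
  obtain ⟨hP, hfix⟩ := riccatiMap_eq_of_tendsto hQ hR .zero hlim
  have hcl := fun {Y : Matrix (Fin n) (Fin n) ℝ} (hY : Y.PosSemidef) =>
    isSchur_closedLoop (B := B) hR hS hAS hY
  refine ⟨P, ⟨hP, isRiccatiSolution_iff.2 hfix⟩, fun Y hY hYr => ?_, ?_⟩
  · have hYfix := isRiccatiSolution_iff.1 hYr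
    exact eq_of_quad_eq hY.transpose_eq hP.transpose_eq fun v => le_antisymm
      (quad_le_of_fixedPoint hQ hR hY hYfix hP hfix (hcl hP hfix) v)
      (quad_le_of_fixedPoint hQ hR hP hfix hY hYfix (hcl hY hYfix) v)
  set M := paramMat A B C L (x 0) Aε ηε₀ with hMdef
  have hG2 := paramMat_mulVec_internalG2 A B C L (x 0) (Aε := Aε) (ηε₀ := ηε₀)
  rw [← hMdef] at hG2
  have hMY : M * (internalG2 n m p * zetaOutput m p) = L :=
    Matrix.mulVec_injective (funext fun v => by
      rw [← Matrix.mulVec_mulVec, ← Matrix.mulVec_mulVec, zetaOutput_mulVec, hG2,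
        Matrix.mulVec_zero, zero_add])
  have hMU : M * (internalG2 n m p * zetaInput m p) = B :=
    Matrix.mulVec_injective (funext fun v => by
      rw [← Matrix.mulVec_mulVec, ← Matrix.mulVec_mulVec, zetaInput_mulVec, hG2,
        Matrix.mulVec_zero, add_zero])
  set 𝓑 := internalG2 n m p * zetaInput m p with h𝓑
  set G1 := internalG1 n m p (A - L * C).charpoly Aε with hG1
  -- The measured output re-enters as `C M η`, which makes the internal model autonomous up to `u`.
  set 𝒜 := G1 + internalG2 n m p * zetaOutput m p * C * M with h𝒜
  have hMG1 : M * G1 = (A - L * C) * M := paramMat_mul_internalG1 A B C L (x 0) hAε hηε₀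
  have hMA : M * 𝒜 = A * M := by
    rw [h𝒜, Matrix.mul_add, hMG1, Matrix.mul_assoc _ C M, ← Matrix.mul_assoc M, hMY,
      Matrix.sub_mul, ← Matrix.mul_assoc L, sub_add_cancel]
  -- `M η` obeys the observer equation and starts at `x 0`, so the observer error is zero
  -- throughout.
  have hxη : ∀ k, x k = M *ᵥ η k := by
    intro k
    induction k with
    | zero => rw [hη₀, hMdef, paramMat_mulVec_etaInit A B C L (x 0) hηε₀]
    | succ k ih =>
      rw [hη, Matrix.mulVec_add, hG2, Matrix.mulVec_mulVec, hMG1, ← Matrix.mulVec_mulVec, ← ih,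
        hx, hy, Matrix.sub_mulVec, ← Matrix.mulVec_mulVec]
      abel
  have hη' : ∀ k, η (k + 1) = 𝒜 *ᵥ η k + 𝓑 *ᵥ u k := by
    intro k
    rw [hη, zetaVec_eq, hy, hxη, h𝒜, h𝓑, Matrix.add_mulVec, Matrix.mulVec_add]
    simp only [Matrix.mulVec_mulVec, Matrix.mul_assoc]
    abel
  have hQb := hQ.transpose_mul_mul_same M
  have hcost : ∀ k : Fin (kN + 1), dataCost y u Qy R kN k
      = quad (Mᵀ * (Cᵀ * Qy * C) * M) (η k) + quad R (u k) := by
    intro k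
    rw [quad_conj _ M, quad_conj Qy, ← hxη, ← hy]
    rfl
  have hrun := isVIRun_iff hQb hR hP₀ hη' hcost hData
  refine ⟨⟨_, (hrun _).2 rfl, fun s hs => (hrun s).1 hs⟩, fun s hs => ?_⟩
  obtain rfl := (hrun s).1 hs
  have hpsd := riccatiMap_iterate_posSemidef (A := 𝒜) (B := 𝓑) hQb hR hP₀
  refine ⟨fun j => isUnit_det_inputWeight hR (hpsd j), ?_⟩
  simp only [fun j => modelIterate_gain (𝒜 := 𝒜) (𝓑 := 𝓑) (Q := Mᵀ * (Cᵀ * Qy * C) * M)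
    (R := R) (hpsd j)]
  rw [← stateGain_pullback hMA hMU]
  have hPb := hP.transpose_mul_mul_same M
  refine (continuousAt_stateGain hR hPb).tendsto.comp ?_
  rcases hstable with hschur | ⟨X, hX, rfl⟩
  · refine tendsto_riccatiMap_iterate hQb hR hP₀ hPb ?_ ?_ ?_
    · rw [riccatiMap_pullback hMA hMU, hfix]
    · rw [stateGain_pullback hMA hMU]
      -- `E` collects the output injection and the feedback, both of which factor through `M`; what
      -- remains on `ker M` is `G1`.
      refine isSchur_of_intertwining (T := A - B * stateGain A B R P) (M := M) (G := G1)
        (E := internalG2 n m p * zetaOutput m p * C - 𝓑 * stateGain A B R P) ?_ ?_ (hcl hP hfix)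
        (isSchur_internalG1 hschur hAε)
      · rw [Matrix.mul_sub, hMA, ← Matrix.mul_assoc, hMU, Matrix.sub_mul, Matrix.mul_assoc B]
      · rw [h𝒜, Matrix.sub_mul, Matrix.mul_assoc 𝓑]
        abel
    -- The lifted iteration from zero is the pullback of the plant iteration from zero, since `Mᵀ *
    -- 0 * M = 0`.
    · have h := tendsto_pullback M hlim
      simp only [← riccatiMap_iterate_pullback hMA hMU] at h
      simpa using h
  · simp only [riccatiMap_iterate_pullback hMA hMU]
    exact tendsto_pullback M (tendsto_riccatiMap_iterate hQ hR hX hP hfix (hcl hP hfix) hlim)
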